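/- Let $a=A^2$, $[n]=\frac{a^n-a^{-n}}{a-a^{-1}}$ and $[n]!=[1][2]\cdots[n]$. Let $\mathcal B=\mathbb Z[A^{\pm1}][z]$ be the Kauffman bracket skein module of the solid torus (crossing $=A\cdot$(one smoothing)$+A^{-1}\cdot$(other smoothing), trivial circle $=-a-a^{-1}$), where $z^n$ is the class of $n$ parallel copies of the core, and let $\mathcal B^{ev}\subset\mathcal B$ be the submodule generated by the even powers of $z$. Let $t:\mathcal B\to\mathcal B$ be the map induced by a full right-handed twist of the solid torus, let $\langle\cdot,\cdot\rangle$ be the $\mathbb Z[A^{\pm1}]$-valued bilinear form on $\mathcal B$ obtained by cabling the zero-framed Hopf link and taking the Kauffman bracket in $S^3$ (normalized to be $1$ on the empty link), and put $\langle x\rangle=\langle x,1\rangle$. Let $\mu_i=(-1)^iA^{i^2+2i}$ (the eigenvalues of $t$), $\lambda_i=-a^{i+1}-a^{-i-1}$ and $R_n=\prod_{i=0}^{n-1}(z-\lambda_{2i})$. Let $\widehat{\mathcal B}=\varprojlim_n \mathbb Q(A)[z]/(R_n)$ be the algebra of formal series $\sum_{n\ge0}c_nR_n$ with $c_n\in\mathbb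 Q(A)$. There is exactly one element $\omega=\sum_n c_nR_n\in\widehat{\mathcal B}$ such that $\langle\omega,x\rangle=\langle t(x)\rangle$ for every $x\in\mathcal B^{ev}$, where $\langle\omega,x\rangle=\sum_n c_n\langle R_n,x\rangle$ is a finite sum. This $\omega$ is invertible in $\widehat{\mathcal B}$, and for every $p\in\mathbb Z$ the (unique) coefficients in the expansion $\omega^p=\sum_{n\ge0}c_{n,p}R_n$ are $$c_{n,p}=\frac1{(a-a^{-1})^{2n}}\sum_{k=0}^n\frac{(-1)^k\mu_{2k}^p\,[2k+1]}{[n+k+1]!\,[n-k]!}\qquad(n\ge0).$$ -/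

import Mathlib

open Polynomial
open scoped LaurentPolynomial

namespace KauffmanSkein

noncomputable section

/-! ### Ground ring -/

/-- The ground ring `ℤ[A^{±1}]`. -/
abbrev Ground : Type := ℤ[T;T⁻¹]

/-- The power `A ^ k`, `k ∈ ℤ`, of the variable. -/
def A (k : ℤ) : Ground := LaurentPolynomial.T k

/-- The power `a ^ k` of `a = A ^ 2`. -/
def a (k : ℤ) : Ground := A (2 * k)

/-- The value `-a - a⁻¹` of a trivial circle. -/
def circleValue : Ground := -a 1 - a (-1)

/-- The skein module `ℬ = ℤ[A^{±1}][z]` of the solid torus (thickened annulus);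
`z ^ n` is the class of `n` parallel copies of the core. -/
abbrev Skein : Type := Ground[X]

/-! ### Link diagrams in the annulus and their Kauffman bracket

All diagrams needed below are closures, in an annulus, of braid-like diagrams on `n` vertical
strands (numbered `0, …, n - 1`), whose strands may carry small curls. -/

/-- The elementary pieces of a diagram: `cross i` is the positive crossing of the
strands in positions `i` and `i + 1`; `curl i` is a small positive curl in the strand in
position `i`. -/
inductive Piece : Type
  | cross (i : ℕ) : Piece
  | curl (i : ℕ) : Piece

/-- A crossingless diagram on `n` strands is a word `E` in the turn-backs
(`E[k] = i` means that at height `k` the strands `i` and `i + 1` are replaced by a cap and a cup).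
`(k, j)` is the point in position `j` between the heights `k - 1` and `k`.
`Joined n E` says that two such points are joined by one elementary arc of the annular
closure of the diagram. -/
inductive Joined (n : ℕ) (E : List ℕ) :
    Fin (E.length + 1) × Fin n → Fin (E.length + 1) × Fin n → Prop
  | through (k : Fin E.length) (j : Fin n) (h : (j : ℕ) ≠ E[k]) (h' : (j : ℕ) ≠ E[k] + 1) :
      Joined n E (k.castSucc, j) (k.succ, j)
  | cap (k : Fin E.length) (i j : Fin n) (hi : (i : ℕ) = E[k]) (hj : (j : ℕ) = E[k] + 1) :
      Joined n E (k.castSucc, i) (k.castSucc, j)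
  | cup (k : Fin E.length) (i j : Fin n) (hi : (i : ℕ) = E[k]) (hj : (j : ℕ) = E[k] + 1) :
      Joined n E (k.succ, i) (k.succ, j)
  | close (j : Fin n) : Joined n E (Fin.last E.length, j) (0, j)

/-- The circles of the annular closure of a crossingless diagram: the connected components of its
set of arcs. -/
def Circle (n : ℕ) (E : List ℕ) : Type := Quot (Joined n E)

/-- A circle is essential in the annulus (parallel to the core) if and only if it meets the radial
seam, which contains the points `(0, j)`, in an odd number of points; otherwise it
bounds a disk. -/
def Circle.Essential {n : ℕ} {E : List ℕ} (c : Circle n E) : Prop :=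
  Odd (Nat.card {j : Fin n // Quot.mk (Joined n E) (0, j) = c})

/-- The class in `ℬ` of the annular closure of a crossingless diagram. -/
def flatClass (n : ℕ) (E : List ℕ) : Skein :=
  C circleValue ^ Nat.card {c : Circle n E // ¬ c.Essential} *
    X ^ Nat.card {c : Circle n E // c.Essential}

/-- Resolution of the crossings of a diagram, one after the other, by the Kauffman relation
`crossing = A · (one smoothing) + A⁻¹ · (other smoothing)`; `E` is the crossingless part
obtained so far. The smoothings of `cross i` are two vertical strands and the turn-back at `i`;
those of a curl are the straight strand with a trivial circle beside it and the straight strand. -/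
def resolve (n : ℕ) : List Piece → List ℕ → Skein
  | [], E => flatClass n E
  | Piece.cross i :: D, E => A 1 • resolve n D E + A (-1) • resolve n D (E ++ [i])
  | Piece.curl _ :: D, E => A 1 • circleValue • resolve n D E + A (-1) • resolve n D E

/-- The class in `ℬ` of the annular closure of a diagram on `n` strands
(with blackboard framing). -/
def annularClass (n : ℕ) (D : List Piece) : Skein := resolve n D []

/-- The Kauffman bracket, in `S³`, of the closure of a diagram on `n` strands: the annulus
lies in the plane, where every circle has the value `-a - a⁻¹`. -/
def bracket (n : ℕ) (D : List Piece) : Ground := (annularClass n D).eval circleValue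

/-! ### The twist map and the Hopf pairing -/

/-- The crossings `i, i + 1, …, i + n - 1`: the strand in position `i` passes across the next `n`
strands to its right. -/
def passRight (i n : ℕ) : List Piece := (List.range n).map fun j => Piece.cross (i + j)

/-- The block of the first `m` strands passes across the block of the next `n` strands. -/
def blockCross (m n : ℕ) : List Piece :=
  ((List.range m).reverse.map fun i => passRight i n).flatten

/-- The braid whose closure is the zero-framed Hopf link with one component replaced by `m` and the
other by `n` parallel copies. -/
def hopfCable (m n : ℕ) : List Piece := blockCross m n ++ blockCross n m

/-- The last of `n + 1` strands runs once around the first `n` strands. -/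
def runAround (n : ℕ) : List Piece :=
  ((List.range n).reverse.map Piece.cross) ++ (List.range n).map Piece.cross

/-- The positive full twist braid on `n` strands. -/
def fullTwist : ℕ → List Piece
  | 0 => []
  | n + 1 => fullTwist n ++ runAround n

/-- The image of `n` parallel copies of the core under a full right-handed twist of the solid
torus: the bands undergo a full twist as a whole, hence each of them also gets a full twist, which
is drawn as a curl. -/
def twistedCable (n : ℕ) : List Piece := fullTwist n ++ (List.range n).map Piece.curl

/-- The twist map `t : ℬ → ℬ` induced by a full right-handed twist of the solid torus. -/
def twist (x : Skein) : Skein := x.sum fun n c => c • annularClass n (twistedCable n)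

/-- The bilinear form `⟨x, y⟩` on `ℬ` given by cabling the zero-framed Hopf link with `x`
and `y` and taking the bracket. -/
def pairing (x y : Skein) : Ground :=
  x.sum fun m c => y.sum fun n d => c * d * bracket (m + n) (hopfCable m n)

/-- `⟨x⟩ = ⟨x, 1⟩`. -/
def value (x : Skein) : Ground := pairing x 1

/-- The even part of `ℬ`. -/
def evenPart : Submodule Ground Skein :=
  Submodule.span Ground (Set.range fun k : ℕ => (X : Skein) ^ (2 * k))

/-- `λ_i = -a^{i+1} - a^{-i-1}`. -/
def lam (i : ℕ) : Ground := -a (i + 1) - a (-(i + 1))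

/-- `R_n = ∏_{i < n} (z - λ_{2i})`. -/
def R (n : ℕ) : Skein := ∏ i ∈ Finset.range n, (X - C (lam (2 * i)))

/-! ### The completed algebra containing `ω` -/

/-- The field `ℚ(A)`. -/
abbrev K : Type := FractionRing Ground

/-- `R_n` with coefficients in `ℚ(A)`. -/
def RK (n : ℕ) : K[X] := (R n).map (algebraMap Ground K)

theorem span_RK_succ_le (n : ℕ) :
    Ideal.span {RK (n + 1)} ≤ Ideal.span {RK n} := by
  rw [Ideal.span_singleton_le_span_singleton]
  simp only [RK, R, Finset.prod_range_succ, Polynomial.map_mul]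
  exact dvd_mul_right _ _

/-- The algebra of formal sums `∑ c_n R_n` with `c_n ∈ ℚ(A)`, that is, the inverse limit of the
algebras `ℚ(A)[z] / (R_n)` (recall that `R_n` divides `R_{n+1}`). -/
def Completed : Subring (∀ n : ℕ, K[X] ⧸ Ideal.span {RK n}) where
  carrier := {f | ∀ n, Ideal.Quotient.factor (span_RK_succ_le n) (f (n + 1)) = f n}
  mul_mem' := by
    intro f g hf hg n
    simp only [Pi.mul_apply, map_mul, hf n, hg n]
  one_mem' := by
    intro n
    simp only [Pi.one_apply, map_one]
  add_mem' := by
    intro f g hf hg n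
    simp only [Pi.add_apply, map_add, hf n, hg n]
  zero_mem' := by
    intro n
    simp only [Pi.zero_apply, map_zero]
  neg_mem' := by
    intro f hf n
    simp only [Pi.neg_apply, map_neg, hf n]

/-- `f = ∑_n c_n R_n` in the completed algebra. -/
def HasExpansion (f : Completed) (c : ℕ → K) : Prop :=
  ∀ N : ℕ, (f : ∀ n : ℕ, K[X] ⧸ Ideal.span {RK n}) N =
    Ideal.Quotient.mk _ (∑ n ∈ Finset.range N, C (c n) * RK n)

/-- `f = ∑_n c_n R_n` satisfies `⟨f, x⟩ = ⟨t(x)⟩` for every even `x`, where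
`⟨f, x⟩ = ∑_n c_n ⟨R_n, x⟩` is a finite sum (its partial sums are eventually constant). -/
def InducesTwist (f : Completed) : Prop :=
  ∃ c : ℕ → K, HasExpansion f c ∧ ∀ x ∈ evenPart, ∀ᶠ N in Filter.atTop,
    ∑ n ∈ Finset.range N, c n * algebraMap Ground K (pairing (R n) x) =
      algebraMap Ground K (value (twist x))

/-! ### The quantities in the formula -/

/-- `A` as an element of `ℚ(A)`. -/
def AK : K := algebraMap Ground K (A 1)

/-- `a = A ^ 2` as an element of `ℚ(A)`. -/
def aK : K := AK ^ 2

/-- The quantum integer `[n] = (a^n - a^{-n}) / (a - a^{-1})`. -/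
def qInt (n : ℕ) : K := (aK ^ n - (aK ^ n)⁻¹) / (aK - aK⁻¹)

/-- The quantum factorial `[n]! = [1] [2] ⋯ [n]`. -/
def qFactorial (n : ℕ) : K := ∏ i ∈ Finset.range n, qInt (i + 1)

/-- The twist eigenvalues `μ_i = (-1)^i A^{i² + 2i}`. -/
def mu (i : ℕ) : K := (-1) ^ i * AK ^ (i ^ 2 + 2 * i)

end

end KauffmanSkein

/-!
Pairing with the Chebyshev polynomial `S_n(z)`, that is, cabling one component of the Hopf link
with the `n`-th Jones–Wenzl idempotent, evaluates the other component: `⟨x, S_n⟩ = Δ_n x(λ_n)`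
with `Δ_n = ⟨S_n⟩ ≠ 0`. Likewise the twist acts on `S_n` by the scalar `μ_n`. As the even part is
spanned by the `S_{2k}`, the condition on `ω` says that the series `ω(z)` takes the value
`μ_{2k}` at `z = λ_{2k}`. These points are pairwise distinct and are the roots of the `R_n`, so
that the completed algebra is the algebra of all functions on them. Hence `ω` exists, is unique
and invertible, and its power `ω^p` is the function `λ_{2k} ↦ μ_{2k}^p`. The expansion of a
function in the `R_n` is its Newton interpolation series, whose coefficients are divided
differences.
-/

namespace KauffmanSkein

noncomputable section

/-! ### Counting circles by their two-colourings -/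

section Path

variable {S ι : Type*} (r : ι → S → S → Prop)

/-- The `0`-`1` matrix of a relation, used to count chains of related elements. -/
def relMatrix (r : S → S → Prop) [DecidableRel r] : Matrix S S ℕ :=
  Matrix.of fun s t => if r s t then 1 else 0

/-- The chains from `s` to `t` whose `k`-th step is a step of the relation `r (L[k])`. -/
def Path (L : List ι) (s t : S) : Type _ :=
  {g : Fin (L.length + 1) → S //
    g 0 = s ∧ g (Fin.last _) = t ∧ ∀ k : Fin L.length, r L[k] (g k.castSucc) (g k.succ)}

variable {r}

theorem card_path_nil [DecidableEq S] (s t : S) :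
    Nat.card (Path r [] s t) = if s = t then 1 else 0 := by
  split_ifs with h
  · subst h
    have : Unique (Path r [] s s) :=
      { default := ⟨fun _ => s, rfl, rfl, fun k => k.elim0⟩
        uniq := by
          rintro ⟨g, hg, -⟩
          refine Subtype.ext (funext fun k => ?_)
          rw [Fin.fin_one_eq_zero k]
          exact hg }
    exact Nat.card_unique
  · have : IsEmpty (Path r [] s t) := ⟨fun g => h (g.2.1.symm.trans g.2.2.1)⟩
    exact Nat.card_of_isEmpty

/-- A path splits into its first step and the rest. -/
def pathConsEquiv (i : ι) (L : List ι) (s t : S) :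
    Path r (i :: L) s t ≃ Σ u : {u // r i s u}, Path r L u t where
  toFun g := ⟨⟨g.1 1, (congrArg (r i · (g.1 1)) g.2.1).mp (g.2.2.2 0)⟩,
    fun k => g.1 k.succ, rfl, g.2.2.1, fun k => g.2.2.2 k.succ⟩
  invFun g := ⟨Fin.cons s g.2.1, rfl, g.2.2.2.1, Fin.cases
    (show r i s (g.2.1 0) from g.2.2.1.symm ▸ g.1.2) fun k => g.2.2.2.2 k⟩
  left_inv := by
    rintro ⟨g, rfl, -⟩
    exact Subtype.ext (Fin.cons_self_tail g)
  right_inv := by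
    rintro ⟨⟨u, hu⟩, g, hg, -⟩
    obtain rfl : g 0 = u := hg
    rfl

theorem prod_relMatrix_apply [Fintype S] [DecidableEq S] [∀ i, DecidableRel (r i)] (L : List ι)
    (s t : S) : (L.map fun i => relMatrix (r i)).prod s t = Nat.card (Path r L s t) := by
  induction L generalizing s with
  | nil => rw [card_path_nil, List.map_nil, List.prod_nil, Matrix.one_apply]
  | cons i L ih =>
    have (u : S) : Finite (Path r L u t) := inferInstanceAs (Finite (Subtype _))
    rw [Nat.card_congr (pathConsEquiv i L s t), Nat.card_sigma, List.map_cons, List.prod_cons,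
      Matrix.mul_apply]
    simp only [ih]
    simp only [relMatrix, Matrix.of_apply, ite_mul, one_mul, zero_mul]
    rw [← Finset.sum_filter]
    exact Finset.sum_subtype _ (by simp) fun u => Nat.card (Path r L u t)

end Path

/-- The colourings `s` of the points below and `t` of the points above a turn-back at `i` that are
restrictions of a colouring of its arcs. -/
def Extends (n i : ℕ) (s t : Fin n → Bool) : Prop :=
  (∀ j : Fin n, (j : ℕ) ≠ i → (j : ℕ) ≠ i + 1 → s j = t j) ∧
    (∀ p q : Fin n, (p : ℕ) = i → (q : ℕ) = i + 1 → s p = s q) ∧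
    (∀ p q : Fin n, (p : ℕ) = i → (q : ℕ) = i + 1 → t p = t q)

instance (n i : ℕ) : DecidableRel (Extends n i) := fun _ _ =>
  inferInstanceAs (Decidable (_ ∧ _))

/-- The matrix that counts the colourings of a turn-back with given boundary colours. -/
def transfer (n i : ℕ) : Matrix (Fin n → Bool) (Fin n → Bool) ℕ := relMatrix (Extends n i)

/-- The matrix that counts the colourings of a crossingless diagram with given boundary colours. -/
def transferWord (n : ℕ) (E : List ℕ) : Matrix (Fin n → Bool) (Fin n → Bool) ℕ :=
  (E.map (transfer n)).prod

theorem transferWord_cons (n i : ℕ) (E : List ℕ) :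
    transferWord n (i :: E) = transfer n i * transferWord n E := by
  rw [transferWord, List.map_cons, List.prod_cons, transferWord]

theorem transferWord_singleton (n i : ℕ) : transferWord n [i] = transfer n i := by
  rw [transferWord, List.map_singleton, List.prod_singleton]

theorem transferWord_append (n : ℕ) (E F : List ℕ) :
    transferWord n (E ++ F) = transferWord n E * transferWord n F := by
  rw [transferWord, List.map_append, List.prod_append, transferWord, transferWord]

/-- The number of circles of the closure of a crossingless diagram. -/
def circleCount (n : ℕ) (E : List ℕ) : ℕ := Nat.card (Circle n E)

instance (n : ℕ) (E : List ℕ) : Finite (Circle n E) :=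
  inferInstanceAs (Finite (Quot _))

/-- Colouring the circles of a closure is the same as colouring its points level by level. -/
def circleColouringEquiv (n : ℕ) (E : List ℕ) :
    (Circle n E → Bool) ≃ Σ s : Fin n → Bool, Path (Extends n) E s s where
  toFun φ := ⟨fun j => φ (Quot.mk _ (0, j)), fun k j => φ (Quot.mk _ (k, j)), rfl,
    funext fun j => congrArg φ (Quot.sound (Joined.close j)), fun k =>
      ⟨fun j h h' => congrArg φ (Quot.sound (Joined.through k j h h')),
        fun p q h h' => congrArg φ (Quot.sound (Joined.cap k p q h h')),
        fun p q h h' => congrArg φ (Quot.sound (Joined.cup k p q h h'))⟩⟩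
  invFun g := Quot.lift (fun p => g.2.1 p.1 p.2) (by
    rintro _ _ (⟨k, j, h, h'⟩ | ⟨k, p, q, h, h'⟩ | ⟨k, p, q, h, h'⟩ | j)
    · exact (g.2.2.2.2 k).1 j h h'
    · exact (g.2.2.2.2 k).2.1 p q h h'
    · exact (g.2.2.2.2 k).2.2 p q h h'
    · exact congrFun (g.2.2.2.1.trans g.2.2.1.symm) j)
  left_inv φ := by
    ext ⟨p⟩
    rfl
  right_inv := by
    rintro ⟨s, g, rfl, -⟩
    rfl

theorem trace_transferWord (n : ℕ) (E : List ℕ) :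
    (transferWord n E).trace = 2 ^ circleCount n E := by
  have (s : Fin n → Bool) : Finite (Path (Extends n) E s s) :=
    inferInstanceAs (Finite (Subtype _))
  calc (transferWord n E).trace = ∑ s, Nat.card (Path (Extends n) E s s) :=
        Finset.sum_congr rfl fun s _ => prod_relMatrix_apply E s s
    _ = Nat.card (Circle n E → Bool) := by
        rw [Nat.card_congr (circleColouringEquiv n E), Nat.card_sigma]
    _ = 2 ^ circleCount n E := by
        rw [Nat.card_fun, Nat.card_eq_fintype_card, Fintype.card_bool, circleCount]

theorem circleCount_eq_add_of_trace {n m : ℕ} {E F : List ℕ} {k : ℕ}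
    (h : (transferWord n E).trace = 2 ^ k * (transferWord m F).trace) :
    circleCount n E = circleCount m F + k := by
  rw [trace_transferWord, trace_transferWord, ← pow_add] at h
  rw [Nat.pow_right_injective le_rfl h, add_comm]

theorem circleCount_eq_of_trace {n m : ℕ} {E F : List ℕ}
    (h : (transferWord n E).trace = (transferWord m F).trace) :
    circleCount n E = circleCount m F :=
  circleCount_eq_add_of_trace (k := 0) (by rw [h, pow_zero, one_mul])

theorem circleCount_append_comm (n : ℕ) (E F : List ℕ) :
    circleCount n (E ++ F) = circleCount n (F ++ E) :=
  circleCount_eq_of_trace (by rw [transferWord_append, transferWord_append, Matrix.trace_mul_comm])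

theorem circleCount_nil (n : ℕ) : circleCount n [] = n := by
  have h := trace_transferWord n []
  simp only [transferWord, List.map_nil, List.prod_nil, Matrix.trace_one, Fintype.card_pi,
    Fintype.card_bool, Finset.prod_const, Finset.card_univ, Fintype.card_fin, Nat.cast_pow] at h
  exact (Nat.pow_right_injective le_rfl h).symm

/-! ### Local relations between turn-backs -/

/-- Recolouring of the points `i` and `i + 1` by the colour `x`. -/
def recolour {n : ℕ} (i : ℕ) (x : Bool) (s : Fin n → Bool) (j : Fin n) : Bool :=
  if (j : ℕ) = i ∨ (j : ℕ) = i + 1 then x else s j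

theorem recolour_injective {n i : ℕ} (hi : i < n) (s : Fin n → Bool) :
    Function.Injective fun x => recolour i x s := by
  intro x y h
  simpa [recolour] using congrFun h ⟨i, hi⟩

theorem extends_iff {n i : ℕ} (hi : i + 1 < n) (s t : Fin n → Bool) :
    Extends n i s t ↔
      s ⟨i, by omega⟩ = s ⟨i + 1, hi⟩ ∧ t ∈ Set.range fun x => recolour i x s := by
  constructor
  · rintro ⟨hst, hs, ht⟩
    refine ⟨hs _ _ rfl rfl, t ⟨i, by omega⟩, funext fun j => ?_⟩
    simp only [recolour]
    split_ifs with hj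
    · rcases hj with rfl | hj
      · rfl
      · exact ht _ _ rfl hj
    · rw [not_or] at hj
      exact hst j hj.1 hj.2
  · rintro ⟨hs, x, rfl⟩
    refine ⟨fun j hj hj' => by simp [recolour, hj, hj'], ?_, ?_⟩
    · rintro ⟨p, _⟩ ⟨q, _⟩ rfl rfl
      exact hs
    · intro p q hp hq
      simp [recolour, hp, hq]

theorem transfer_mulVec {n i : ℕ} (hi : i + 1 < n) (v : (Fin n → Bool) → ℕ) (s : Fin n → Bool) :
    (transfer n i).mulVec v s =
      if s ⟨i, by omega⟩ = s ⟨i + 1, hi⟩ then ∑ x, v (recolour i x s) else 0 := by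
  classical
  simp only [Matrix.mulVec, dotProduct, transfer, relMatrix, Matrix.of_apply, extends_iff hi,
    ite_mul, one_mul, zero_mul]
  split_ifs with h
  · rw [← Finset.sum_image (recolour_injective (by omega) s).injOn, ← Finset.sum_filter]
    simp only [h, true_and, ← Set.mem_toFinset, Finset.filter_univ_mem, Set.toFinset_range]
  · simp [h]

theorem transfer_sq {n i : ℕ} (hi : i + 1 < n) :
    transfer n i * transfer n i = 2 • transfer n i := by
  refine Matrix.ext_iff_mulVec.2 fun v => funext fun s => ?_
  have absorb (x y : Bool) : recolour i x (recolour i y s) = recolour i x s := by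
    ext j
    simp only [recolour]
    split_ifs <;> rfl
  simp only [← Matrix.mulVec_mulVec, Matrix.smul_mulVec, Pi.smul_apply, transfer_mulVec hi, absorb]
  simp [recolour, two_mul]

theorem transfer_mul_transfer_mul_transfer {n i j : ℕ} (hi : i + 1 < n) (hj : j + 1 < n)
    (hij : i + 1 = j ∨ j + 1 = i) : transfer n i * transfer n j * transfer n i = transfer n i := by
  refine Matrix.ext_iff_mulVec.2 fun v => funext fun s => ?_
  obtain ⟨k, hk, hijk⟩ : ∃ k, ∃ _ : k < n, i + 1 = j ∧ k = i + 2 ∨ j + 1 = i ∧ k = j := by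
    rcases hij with h | h
    · exact ⟨i + 2, by omega, .inl ⟨h, rfl⟩⟩
    · exact ⟨j, by omega, .inr ⟨h, rfl⟩⟩
  have absorb (x z : Bool) :
      recolour i z (recolour j (s ⟨k, hk⟩) (recolour i x s)) = recolour i z s := by
    ext m
    simp only [recolour]
    grind
  have joined_below (x : Bool) :
      recolour i x s ⟨j, by omega⟩ = recolour i x s ⟨j + 1, hj⟩ ↔ x = s ⟨k, hk⟩ := by
    simp only [recolour]
    grind
  have joined_above (x y : Bool) : recolour j y (recolour i x s) ⟨i, by omega⟩ =
      recolour j y (recolour i x s) ⟨i + 1, hi⟩ ↔ y = x := by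
    simp only [recolour]
    grind
  simp only [← Matrix.mulVec_mulVec, transfer_mulVec hi, transfer_mulVec hj, joined_below,
    joined_above, Finset.sum_ite_eq', Finset.mem_univ, if_true, absorb]

theorem transfer_comm {n i j : ℕ} (hij : i + 2 ≤ j) (hj : j + 1 < n) :
    transfer n i * transfer n j = transfer n j * transfer n i := by
  refine Matrix.ext_iff_mulVec.2 fun v => funext fun s => ?_
  have recolour_comm (x y : Bool) :
      recolour i x (recolour j y s) = recolour j y (recolour i x s) := by
    ext k
    simp only [recolour]
    split_ifs <;> first | rfl | omega
  have off_i : j ≠ i ∧ j ≠ i + 1 ∧ j + 1 ≠ i := by omega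
  simp only [← Matrix.mulVec_mulVec, transfer_mulVec (show i + 1 < n by omega),
    transfer_mulVec hj, recolour_comm]
  simp only [recolour, off_i, off_i.1.symm, off_i.2.1.symm, off_i.2.2.symm,
    Nat.add_right_cancel_iff, or_self, if_false]
  split_ifs
  · exact Finset.sum_comm
  all_goals simp

/-! ### Adding a strand -/

open scoped Kronecker

/-- A colouring of `n + 1` points as the colour of the last point and a colouring of the others. -/
abbrev snocColour (n : ℕ) : Bool × (Fin n → Bool) ≃ (Fin (n + 1) → Bool) :=
  Fin.snocEquiv fun _ => Bool

theorem transfer_snoc {n i : ℕ} (hi : i + 1 < n) :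
    (transfer (n + 1) i).submatrix (snocColour n) (snocColour n) =
      1 ⊗ₖ transfer n i := by
  have h1 : n ≠ i := by omega
  have h2 : n ≠ i + 1 := by omega
  ext ⟨x, s⟩ ⟨y, t⟩
  have : Extends (n + 1) i (snocColour n (x, s)) (snocColour n (y, t)) ↔
      x = y ∧ Extends n i s t := by
    simp only [Extends, Fin.forall_fin_succ', Fin.snocEquiv_apply, Fin.snoc_castSucc,
      Fin.snoc_last, Fin.val_castSucc, Fin.val_last, h1, h2, ne_eq, not_false_eq_true,
      true_imp_iff, false_imp_iff, implies_true, and_true]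
    tauto
  simp only [transfer, relMatrix, Matrix.submatrix_apply, Matrix.of_apply, this,
    Matrix.kroneckerMap_apply, Matrix.one_apply, ite_mul, one_mul, zero_mul, ite_and]

theorem transferWord_snoc {n : ℕ} {E : List ℕ} (hE : ∀ i ∈ E, i + 1 < n) :
    (transferWord (n + 1) E).submatrix (snocColour n) (snocColour n) =
      1 ⊗ₖ transferWord n E := by
  induction E with
  | nil => simp [transferWord]
  | cons i E ih =>
    rw [List.forall_mem_cons] at hE
    rw [transferWord_cons, transferWord_cons, ← Matrix.submatrix_mul_equiv _ _ _ (snocColour n) _,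
      transfer_snoc hE.1, ih hE.2, ← Matrix.mul_kronecker_mul, one_mul]

theorem trace_submatrix_equiv {m n R : Type*} [Fintype m] [Fintype n] [AddCommMonoid R]
    (e : m ≃ n) (M : Matrix n n R) : (M.submatrix e e).trace = M.trace :=
  e.sum_comp fun i => M i i

theorem circleCount_succ {n : ℕ} {E : List ℕ} (hE : ∀ i ∈ E, i + 1 < n) :
    circleCount (n + 1) E = circleCount n E + 1 := by
  refine circleCount_eq_add_of_trace ?_
  rw [← trace_submatrix_equiv (snocColour n), transferWord_snoc hE, Matrix.trace_kronecker,
    Matrix.trace_one, Fintype.card_bool, pow_one, Nat.cast_two]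

theorem circleCount_add {n : ℕ} {E : List ℕ} (hE : ∀ i ∈ E, i + 1 < n) (k : ℕ) :
    circleCount (n + k) E = circleCount n E + k := by
  induction k with
  | zero => rfl
  | succ k ih =>
    rw [← add_assoc, circleCount_succ fun i hi => (hE i hi).trans_le (Nat.le_add_right _ _), ih,
      add_assoc]

theorem transfer_last_snoc (n : ℕ) (s t : Fin (n + 1) → Bool) (x : Bool) :
    transfer (n + 2) n (snocColour (n + 1) (x, t)) (snocColour (n + 1) (x, s)) =
      if x = s (Fin.last n) then (if t = s then 1 else 0) else 0 := by
  have h1 (j : Fin n) : (j : ℕ) ≠ n := j.2.ne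
  have h2 (j : Fin n) : (j : ℕ) ≠ n + 1 := by omega
  have : Extends (n + 2) n (snocColour (n + 1) (x, t)) (snocColour (n + 1) (x, s)) ↔
      x = s (Fin.last n) ∧ t = s := by
    simp only [Extends, Fin.forall_fin_succ' (n := n + 1), Fin.snocEquiv_apply, Fin.snoc_castSucc,
      Fin.snoc_last, Fin.val_castSucc, Fin.val_last, funext_iff]
    simp only [Fin.forall_fin_succ' (n := n), Fin.val_castSucc, Fin.val_last]
    simp [h1, h2]
    grind
  simp only [transfer, relMatrix, Matrix.of_apply, this, ite_and]

theorem circleCount_markov {n : ℕ} {E : List ℕ} (hE : ∀ i ∈ E, i + 1 < n + 1) :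
    circleCount (n + 2) (E ++ [n]) = circleCount (n + 1) E := by
  refine circleCount_eq_of_trace ?_
  rw [← trace_submatrix_equiv (snocColour (n + 1)), transferWord_append,
    ← Matrix.submatrix_mul_equiv _ _ _ (snocColour (n + 1)) _, transferWord_snoc hE,
    transferWord_singleton]
  simp only [Matrix.trace, Matrix.diag_apply, Matrix.mul_apply, Fintype.sum_prod_type,
    Matrix.kroneckerMap_apply, Matrix.one_apply, ite_mul, one_mul, zero_mul, mul_ite, mul_one,
    mul_zero, Finset.sum_ite_irrel, Finset.sum_const_zero, Finset.sum_ite_eq, Finset.mem_univ,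
    if_true, Matrix.submatrix_apply, transfer_last_snoc]
  rw [Finset.sum_comm]
  simp only [Finset.sum_ite_eq', Finset.mem_univ, if_true]

/-! ### Local moves on words -/

theorem circleCount_congr {n : ℕ} (u v : List ℕ) {w w' : List ℕ}
    (h : transferWord n w = transferWord n w') :
    circleCount n (u ++ w ++ v) = circleCount n (u ++ w' ++ v) :=
  circleCount_eq_of_trace (by simp only [transferWord_append, h])

theorem circleCount_sq {n i : ℕ} (hi : i + 1 < n) (u v : List ℕ) :
    circleCount n (u ++ [i, i] ++ v) = circleCount n (u ++ [i] ++ v) + 1 := by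
  have : transferWord n [i, i] = 2 • transferWord n [i] := by
    rw [transferWord_cons, transferWord_singleton, transfer_sq hi]
  refine circleCount_eq_add_of_trace ?_
  simp only [transferWord_append, this, mul_smul_comm, smul_mul_assoc, Matrix.trace_smul, pow_one,
    smul_eq_mul]

theorem circleCount_zigzag {n i j : ℕ} (hi : i + 1 < n) (hj : j + 1 < n)
    (hij : i + 1 = j ∨ j + 1 = i) (u v : List ℕ) :
    circleCount n (u ++ [i, j, i] ++ v) = circleCount n (u ++ [i] ++ v) :=
  circleCount_congr u v (by
    rw [transferWord_cons, transferWord_cons, transferWord_singleton, ← mul_assoc,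
      transfer_mul_transfer_mul_transfer hi hj hij])

theorem circleCount_comm {n i j : ℕ} (hij : i + 2 ≤ j) (hj : j + 1 < n) (u v : List ℕ) :
    circleCount n (u ++ [i, j] ++ v) = circleCount n (u ++ [j, i] ++ v) :=
  circleCount_congr u v (by
    simp [transferWord, transfer_comm hij hj])

/-! ### The Temperley–Lieb algebra and its Markov trace -/

section Abstract

variable {F : Type*} [CommRing F] {B : Type*} [Ring B] [Algebra F B]

/-- The Temperley–Lieb relations with loop value `δ` for a sequence of turn-backs. -/
structure IsTL (δ : F) (E : ℕ → B) : Prop where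
  sq (i : ℕ) : E i * E i = δ • E i
  zigzag {i j : ℕ} (_ : i + 1 = j ∨ j + 1 = i) : E i * E j * E i = E i
  comm {i j : ℕ} (_ : i + 2 ≤ j) : E i * E j = E j * E i

variable (F) in
/-- The subalgebra generated by the turn-backs on the first `n` strands. -/
def strands (E : ℕ → B) (n : ℕ) : Subalgebra F B :=
  Algebra.adjoin F {x | ∃ i, i + 1 < n ∧ x = E i}

/-- Markov traces, normalized so that adding a strand does not change the value. -/
structure IsMarkov (δ : F) (E : ℕ → B) (τ : B →ₗ[F] F) : Prop where
  one : τ 1 = 1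
  mul_comm (x y : B) : τ (x * y) = τ (y * x)
  markov {n : ℕ} {x : B} (_ : x ∈ strands F E (n + 1)) : δ * τ (x * E n) = τ x

theorem mem_closure_turnBacks {E : ℕ → B} {n : ℕ} {x : B}
    (hx : x ∈ Submonoid.closure {x | ∃ i, i + 1 < n ∧ x = E i}) :
    ∃ w : List ℕ, (∀ i ∈ w, i + 1 < n) ∧ (w.map E).prod = x := by
  induction hx using Submonoid.closure_induction with
  | mem x hx =>
    obtain ⟨i, hi, rfl⟩ := hx
    exact ⟨[i], by simpa using hi, by simp⟩
  | one => exact ⟨[], by simp, by simp⟩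
  | mul _ _ _ _ hx hy =>
    obtain ⟨u, hu, rfl⟩ := hx
    obtain ⟨v, hv, rfl⟩ := hy
    exact ⟨u ++ v, fun i hi => (List.mem_append.1 hi).elim (hu i) (hv i), by simp⟩

theorem strands_induction {E : ℕ → B} {n : ℕ} {P : B → Prop} {x : B} (hx : x ∈ strands F E n)
    (prod : ∀ w : List ℕ, (∀ i ∈ w, i + 1 < n) → P (w.map E).prod)
    (add : ∀ x y, P x → P y → P (x + y)) (smul : ∀ (c : F) x, P x → P (c • x)) : P x := by
  rw [strands, ← Subalgebra.mem_toSubmodule, Algebra.adjoin_eq_span] at hx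
  induction hx using Submodule.span_induction with
  | mem x hx =>
    obtain ⟨w, hw, rfl⟩ := mem_closure_turnBacks hx
    exact prod w hw
  | zero => simpa using smul 0 _ (prod [] (by simp))
  | add x y _ _ hx hy => exact add x y hx hy
  | smul c x _ hx => exact smul c x hx

end Abstract

section Words

theorem add_one_lt_sum_add_two {w : List ℕ} {i : ℕ} (hi : i ∈ w) : i + 1 < w.sum + 2 := by
  have := List.le_sum_of_mem hi
  omega

variable {F : Type*} [Field F] {δ : F}

variable (δ) in
/-- The value of the closure of a word in the turn-backs, normalized to be `1` on straight
strands. By `wordTrace_eq` the number `w.sum + 2` may be replaced by any number of strands on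
which the word makes sense. -/
def wordTrace (w : List ℕ) : F := δ ^ circleCount (w.sum + 2) w / δ ^ (w.sum + 2)

theorem wordTrace_eq (hδ : δ ≠ 0) {n : ℕ} {w : List ℕ} (h : ∀ i ∈ w, i + 1 < n) :
    wordTrace δ w = δ ^ circleCount n w / δ ^ n := by
  have hn := circleCount_add h (w.sum + 2)
  have hw := circleCount_add (fun _ => add_one_lt_sum_add_two (w := w)) n
  rw [add_comm (w.sum + 2) n, hn] at hw
  rw [wordTrace, div_eq_div_iff (pow_ne_zero _ hδ) (pow_ne_zero _ hδ), ← pow_add, ← pow_add, hw]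

theorem wordTrace_append_comm (hδ : δ ≠ 0) (u v : List ℕ) :
    wordTrace δ (u ++ v) = wordTrace δ (v ++ u) := by
  have h (i) (hi : i ∈ u ++ v) : i + 1 < (u ++ v).sum + 2 := add_one_lt_sum_add_two hi
  rw [wordTrace_eq hδ h, wordTrace_eq hδ fun i hi => h i (by grind), circleCount_append_comm]

variable (F) in
/-- Formal linear combinations of words in the turn-backs. -/
abbrev WordAlgebra : Type _ := MonoidAlgebra F (FreeMonoid ℕ)

/-- A word as an element of the algebra of words. -/
def word (w : List ℕ) : WordAlgebra F := MonoidAlgebra.of F _ (FreeMonoid.ofList w)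

theorem word_append (u v : List ℕ) : (word (u ++ v) : WordAlgebra F) = word u * word v := by
  rw [word, FreeMonoid.ofList_append, map_mul, word, word]

theorem word_nil : (word [] : WordAlgebra F) = 1 := by
  rw [word, FreeMonoid.ofList_nil, map_one]

theorem word_induction {P : WordAlgebra F → Prop} (x : WordAlgebra F) (word : ∀ w, P (word w))
    (add : ∀ x y, P x → P y → P (x + y)) (smul : ∀ (c : F) x, P x → P (c • x)) : P x :=
  MonoidAlgebra.induction_on x (fun w => word (FreeMonoid.toList w)) add smul

variable (δ) in
/-- The linear extension of `wordTrace`. -/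
def preTrace : WordAlgebra F →ₗ[F] F :=
  Finsupp.linearCombination F (fun w : FreeMonoid ℕ => wordTrace δ w.toList) ∘ₗ
    (MonoidAlgebra.coeffLinearEquiv F).toLinearMap

theorem preTrace_word (w : List ℕ) : preTrace δ (word w) = wordTrace δ w := by
  simp [preTrace, word, MonoidAlgebra.coeffLinearEquiv]

theorem preTrace_mul_comm (hδ : δ ≠ 0) (x y : WordAlgebra F) :
    preTrace δ (x * y) = preTrace δ (y * x) := by
  induction x using word_induction with
  | word u =>
    induction y using word_induction with
    | word v => rw [← word_append, ← word_append, preTrace_word, preTrace_word,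
        wordTrace_append_comm hδ]
    | add y z hy hz => rw [mul_add, add_mul, map_add, map_add, hy, hz]
    | smul c y hy => rw [mul_smul_comm, smul_mul_assoc, map_smul, map_smul, hy]
  | add y z hy hz => rw [mul_add, add_mul, map_add, map_add, hy, hz]
  | smul c y hy => rw [mul_smul_comm, smul_mul_assoc, map_smul, map_smul, hy]

variable (δ) in
/-- Two combinations of words are congruent if all closures of them agree. -/
def closureCon : RingCon (WordAlgebra F) where
  r x y := ∀ u v, preTrace δ (u * x * v) = preTrace δ (u * y * v)
  iseqv := ⟨fun _ _ _ => rfl, fun h u v => (h u v).symm, fun h h' u v => (h u v).trans (h' u v)⟩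
  add' h h' u v := by simp only [mul_add, add_mul, map_add, h u v, h' u v]
  mul' {w x y z} h h' u v := by
    rw [← mul_assoc, mul_assoc (u * w), h u (y * v), mul_assoc, ← mul_assoc x, ← mul_assoc,
      ← mul_assoc, h' (u * x) v, mul_assoc u]

theorem closureCon_of_words {x y : WordAlgebra F}
    (h : ∀ u v, preTrace δ (word u * x * word v) = preTrace δ (word u * y * word v)) :
    closureCon δ x y := by
  intro u v
  induction u using word_induction with
  | word u =>
    induction v using word_induction with
    | word v => exact h u v
    | add y z hy hz => rw [mul_add, mul_add, map_add, map_add, hy, hz]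
    | smul c y hy => rw [mul_smul_comm, mul_smul_comm, map_smul, map_smul, hy]
  | add y z hy hz => simp only [add_mul, map_add, hy, hz]
  | smul c y hy => simp only [smul_mul_assoc, map_smul, hy]

variable (δ) in
/-- The Temperley–Lieb algebra on infinitely many strands, modulo the radical of its trace. -/
abbrev TLAlgebra : Type _ := (closureCon δ).Quotient

variable (δ) in
/-- The class of a combination of words in the Temperley–Lieb algebra. -/
def toTL : WordAlgebra F →ₐ[F] TLAlgebra δ := (closureCon δ).mkₐ F

variable (δ) in
/-- The Markov trace on the Temperley–Lieb algebra. -/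
def markovTrace : TLAlgebra δ →ₗ[F] F where
  toFun := Quotient.lift (preTrace δ) fun x y h => by simpa using h 1 1
  map_add' x y := by
    induction x using Quotient.inductionOn'
    induction y using Quotient.inductionOn'
    exact map_add (preTrace δ) _ _
  map_smul' c x := by
    induction x using Quotient.inductionOn'
    exact map_smul (preTrace δ) _ _

variable (δ) in
/-- The turn-back at position `i` in the Temperley–Lieb algebra. -/
def turnBack (i : ℕ) : TLAlgebra δ := toTL δ (word [i])

theorem markovTrace_toTL (x : WordAlgebra F) : markovTrace δ (toTL δ x) = preTrace δ x := rfl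

theorem toTL_surjective : Function.Surjective (toTL δ) := (closureCon δ).mkₐ_surjective

theorem toTL_word (w : List ℕ) : toTL δ (word w) = (w.map (turnBack δ)).prod := by
  induction w with
  | nil => rw [word_nil, map_one, List.map_nil, List.prod_nil]
  | cons i w ih =>
    rw [List.map_cons, List.prod_cons, ← ih, turnBack, ← map_mul, ← word_append,
      List.singleton_append]

theorem prod_turnBack_eq_smul (hδ : δ ≠ 0) {x y : List ℕ} {k : ℕ}
    (h : ∀ (n : ℕ) (u v : List ℕ), (∀ i ∈ x ++ y, i + 1 < n) →
      circleCount n (u ++ x ++ v) = circleCount n (u ++ y ++ v) + k) :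
    (x.map (turnBack δ)).prod = δ ^ k • (y.map (turnBack δ)).prod := by
  rw [← toTL_word, ← toTL_word, ← map_smul]
  refine Quotient.sound (closureCon_of_words fun u v => ?_)
  rw [mul_smul_comm, smul_mul_assoc, map_smul, smul_eq_mul]
  simp only [← word_append, preTrace_word]
  have hlt (i) (hi : i ∈ (u ++ x ++ v) ++ y) : i + 1 < ((u ++ x ++ v) ++ y).sum + 2 :=
    add_one_lt_sum_add_two hi
  rw [wordTrace_eq hδ fun i hi => hlt i (by grind), wordTrace_eq hδ fun i hi => hlt i (by grind),
    h _ u v fun i hi => hlt i (by grind), pow_add]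
  ring

theorem isTL_turnBack (hδ : δ ≠ 0) : IsTL δ (turnBack δ) where
  sq i := by
    simpa using prod_turnBack_eq_smul hδ (x := [i, i]) (y := [i]) (k := 1)
      fun n u v h => circleCount_sq (h i (by simp)) u v
  zigzag {i j} hij := by
    simpa [mul_assoc] using prod_turnBack_eq_smul hδ (x := [i, j, i]) (y := [i]) (k := 0)
      fun n u v h => circleCount_zigzag (h i (by simp)) (h j (by simp)) hij u v
  comm {i j} hij := by
    simpa using prod_turnBack_eq_smul hδ (x := [i, j]) (y := [j, i]) (k := 0)
      fun n u v h => circleCount_comm hij (h j (by simp)) u v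

theorem markovTrace_prod_turnBack (w : List ℕ) :
    markovTrace δ (w.map (turnBack δ)).prod = wordTrace δ w := by
  rw [← toTL_word, markovTrace_toTL, preTrace_word]

theorem wordTrace_append_singleton (hδ : δ ≠ 0) {n : ℕ} {w : List ℕ}
    (hw : ∀ i ∈ w, i + 1 < n + 1) : δ * wordTrace δ (w ++ [n]) = wordTrace δ w := by
  have hwn (i) (hi : i ∈ w ++ [n]) : i + 1 < n + 2 := by
    rcases List.mem_append.1 hi with h | h
    · exact (hw i h).trans (by omega)
    · rw [List.mem_singleton.1 h]
      omega
  rw [wordTrace_eq hδ hw, wordTrace_eq hδ hwn, circleCount_markov hw]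
  field_simp
  ring

theorem isMarkov_markovTrace (hδ : δ ≠ 0) : IsMarkov δ (turnBack δ) (markovTrace δ) where
  one := by
    have h := markovTrace_prod_turnBack (δ := δ) []
    rw [wordTrace_eq hδ (n := 0) (by simp), circleCount_nil, List.map_nil, List.prod_nil] at h
    simpa only [pow_zero, div_one] using h
  mul_comm x y := by
    obtain ⟨x, rfl⟩ := toTL_surjective x
    obtain ⟨y, rfl⟩ := toTL_surjective y
    rw [← map_mul, ← map_mul, markovTrace_toTL, markovTrace_toTL, preTrace_mul_comm hδ]
  markov {n x} hx := by
    refine strands_induction (P := fun x => δ * markovTrace δ (x * turnBack δ n) = markovTrace δ x)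
      hx (fun w hw => ?_) (fun x y hx hy => ?_) fun c x hx => ?_
    · have := markovTrace_prod_turnBack (δ := δ) (w ++ [n])
      rw [List.map_append, List.prod_append, List.map_singleton, List.prod_singleton] at this
      rw [this, markovTrace_prod_turnBack, wordTrace_append_singleton hδ hw]
    · rw [add_mul, map_add, mul_add, hx, hy, map_add]
    · rw [smul_mul_assoc, map_smul, map_smul, ← hx, smul_eq_mul, smul_eq_mul, mul_left_comm]

end Words

/-! ### Braids in the Temperley–Lieb algebra -/

section Strands

variable {F : Type*} [CommRing F] {B : Type*} [Ring B] [Algebra F B] {δ : F} {E : ℕ → B}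

theorem mem_strands {i n : ℕ} (h : i + 1 < n) : E i ∈ strands F E n :=
  Algebra.subset_adjoin ⟨i, h, rfl⟩

theorem strands_mono {m n : ℕ} (h : m ≤ n) : strands F E m ≤ strands F E n :=
  Algebra.adjoin_mono fun _ ⟨i, hi, hx⟩ => ⟨i, hi.trans_le h, hx⟩

theorem commute_of_mem_strands {n : ℕ} {x y : B} (hx : x ∈ strands F E n)
    (h : ∀ i, i + 1 < n → Commute (E i) y) : Commute x y := by
  induction hx using Algebra.adjoin_induction with
  | mem x hx =>
    obtain ⟨i, hi, rfl⟩ := hx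
    exact h i hi
  | algebraMap r => exact Algebra.commutes r y
  | add x z _ _ hx hz => exact hx.add_left hz
  | mul x z _ _ hx hz => exact hx.mul_left hz

namespace IsTL

theorem shift (hE : IsTL δ E) (m : ℕ) : IsTL δ fun i => E (m + i) where
  sq i := hE.sq _
  zigzag h := hE.zigzag (by omega)
  comm h := hE.comm (by omega)

theorem op (hE : IsTL δ E) : IsTL δ fun i => MulOpposite.op (E i) where
  sq i := by rw [← MulOpposite.op_mul, hE.sq, MulOpposite.op_smul]
  zigzag h := by rw [← MulOpposite.op_mul, ← MulOpposite.op_mul, ← mul_assoc, hE.zigzag h]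
  comm h := by rw [← MulOpposite.op_mul, ← MulOpposite.op_mul, hE.comm h]

theorem commute_strands (hE : IsTL δ E) {n j : ℕ} {x : B} (hx : x ∈ strands F E n) (h : n ≤ j) :
    Commute x (E j) :=
  commute_of_mem_strands hx fun _ hi => hE.comm (by omega)

end IsTL

end Strands

section Braid

open MulOpposite (op)

variable {F : Type*} [Field F] {B : Type*} [Ring B] [Algebra F B] {δ q : F} {E : ℕ → B}

variable (q) in
/-- The loop value `-q² - q⁻²` of the Kauffman bracket with parameter `q`. -/
def loopValue : F := -q ^ 2 - (q ^ 2)⁻¹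

variable (q E) in
/-- The positive crossing, resolved by the Kauffman relation with parameter `q`. -/
def crossing (i : ℕ) : B := q • 1 + q⁻¹ • E i

theorem op_crossing (i : ℕ) : op (crossing q E i) = crossing q (fun j => op (E j)) i := by
  rw [crossing, MulOpposite.op_add, MulOpposite.op_smul, MulOpposite.op_smul, MulOpposite.op_one,
    crossing]

theorem crossing_mem_strands {i n : ℕ} (h : i + 1 < n) : crossing q E i ∈ strands F E n :=
  add_mem (Subalgebra.smul_mem _ (one_mem _) _) (Subalgebra.smul_mem _ (mem_strands h) _)

theorem semiconjBy_crossing {i j : ℕ} {x : B} (h : SemiconjBy x (E i) (E j)) :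
    SemiconjBy x (crossing q E i) (crossing q E j) :=
  ((SemiconjBy.one_right x).smul_right _).add_right (h.smul_right _)

theorem crossing_mul_mul_crossing (hq : q ≠ 0) (i : ℕ) (x : B) :
    crossing q E i * x * crossing q E i =
      q ^ 2 • x + x * E i + E i * x + (q⁻¹) ^ 2 • (E i * x * E i) := by
  simp only [crossing, add_mul, mul_add, smul_mul_assoc, mul_smul_comm, one_mul, mul_one, smul_add,
    smul_smul, mul_inv_cancel₀ hq, inv_mul_cancel₀ hq, one_smul, pow_two]
  abel

namespace IsTL

theorem commute_strands_crossing (hE : IsTL δ E) {n j : ℕ} {x : B} (hx : x ∈ strands F E n)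
    (h : n ≤ j) : Commute x (crossing q E j) :=
  semiconjBy_crossing (hE.commute_strands hx h)

theorem crossing_mul_self (hE : IsTL (loopValue q) E) (hq : q ≠ 0) (i : ℕ) :
    crossing q E i * E i = (-(q ^ 3)⁻¹) • E i := by
  rw [crossing, add_mul, smul_mul_assoc, smul_mul_assoc, one_mul, hE.sq, smul_smul, ← add_smul,
    loopValue]
  congr 1
  field_simp
  ring

theorem crossing_mul_crossing_mul (hE : IsTL (loopValue q) E) (hq : q ≠ 0) {i j : ℕ}
    (hij : i + 1 = j ∨ j + 1 = i) : crossing q E i * crossing q E j * E i = E j * E i := by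
  calc crossing q E i * crossing q E j * E i
      = (q * q) • E i + (q⁻¹ * q) • (E j * E i) + (q * q⁻¹) • (E i * E i) +
          (q⁻¹ * q⁻¹) • (E i * E j * E i) := by
        simp only [crossing, add_mul, mul_add, smul_mul_assoc, mul_smul_comm, one_mul, mul_one,
          smul_smul, mul_assoc, smul_add]
        abel
    _ = (q * q + loopValue q + q⁻¹ * q⁻¹) • E i + E j * E i := by
        rw [hE.sq, hE.zigzag hij, mul_inv_cancel₀ hq, inv_mul_cancel₀ hq, one_smul, one_smul]
        module
    _ = E j * E i := by
        have : q * q + loopValue q + q⁻¹ * q⁻¹ = 0 := by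
          rw [loopValue]
          ring
        rw [this, zero_smul, zero_add]

theorem mul_crossing_mul_crossing (hE : IsTL (loopValue q) E) (hq : q ≠ 0) {i j : ℕ}
    (hij : i + 1 = j ∨ j + 1 = i) : E j * (crossing q E i * crossing q E j) = E j * E i :=
  MulOpposite.op_injective (by
    simpa only [MulOpposite.op_mul, op_crossing] using
      hE.op.crossing_mul_crossing_mul hq hij.symm)

theorem semiconjBy_crossing_mul_crossing (hE : IsTL (loopValue q) E) (hq : q ≠ 0) {i j : ℕ}
    (hij : i + 1 = j ∨ j + 1 = i) :
    SemiconjBy (crossing q E i * crossing q E j) (E i) (E j) :=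
  (hE.crossing_mul_crossing_mul hq hij).trans (hE.mul_crossing_mul_crossing hq hij).symm

theorem crossing_braid (hE : IsTL (loopValue q) E) (hq : q ≠ 0) {i j : ℕ}
    (hij : i + 1 = j ∨ j + 1 = i) :
    crossing q E i * crossing q E j * crossing q E i =
      crossing q E j * crossing q E i * crossing q E j := by
  rw [mul_assoc (crossing q E j)]
  exact semiconjBy_crossing (hE.semiconjBy_crossing_mul_crossing hq hij)

end IsTL

variable (q E) in
/-- The crossings `i, i + 1, …, i + n - 1`. -/
def ascend (i : ℕ) : ℕ → B
  | 0 => 1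
  | n + 1 => ascend i n * crossing q E (i + n)

variable (q E) in
/-- The crossings `i + n - 1, …, i + 1, i`. -/
def descend (i : ℕ) : ℕ → B
  | 0 => 1
  | n + 1 => crossing q E (i + n) * descend i n

variable (q E) in
/-- The strand in position `i + n` runs once around the `n` strands to its left. -/
def around (i n : ℕ) : B := descend q E i n * ascend q E i n

variable (q E) in
/-- A block of `m` strands passes across a block of `n` strands. -/
def block : ℕ → ℕ → B
  | 0, _ => 1
  | m + 1, n => ascend q E m n * block m n

variable (q E) in
/-- The full twist on the first `n` strands. -/
def twistValue : ℕ → B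
  | 0 => 1
  | n + 1 => twistValue n * around q E 0 n

theorem ascend_mem (i n : ℕ) : ascend q E i n ∈ strands F E (i + n + 1) := by
  induction n with
  | zero => exact one_mem _
  | succ n ih => exact mul_mem (strands_mono (by omega) ih) (crossing_mem_strands (by omega))

theorem descend_mem (i n : ℕ) : descend q E i n ∈ strands F E (i + n + 1) := by
  induction n with
  | zero => exact one_mem _
  | succ n ih => exact mul_mem (crossing_mem_strands (by omega)) (strands_mono (by omega) ih)

theorem around_mem (i n : ℕ) : around q E i n ∈ strands F E (i + n + 1) :=
  mul_mem (descend_mem i n) (ascend_mem i n)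

theorem block_mem (m n : ℕ) : block q E m n ∈ strands F E (m + n) := by
  induction m with
  | zero => exact one_mem _
  | succ m ih =>
    exact mul_mem (strands_mono (by omega) (ascend_mem m n)) (strands_mono (by omega) ih)

theorem twistValue_mem (n : ℕ) : twistValue q E n ∈ strands F E n := by
  induction n with
  | zero => exact one_mem _
  | succ n ih =>
    exact mul_mem (strands_mono (by omega) ih) (strands_mono (by omega) (around_mem 0 n))

theorem ascend_shift (m i n : ℕ) :
    ascend q (fun j => E (m + j)) i n = ascend q E (m + i) n := by
  induction n with
  | zero => rfl
  | succ n ih => rw [ascend, ascend, ih, crossing, crossing, add_assoc]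

theorem descend_shift (m i n : ℕ) :
    descend q (fun j => E (m + j)) i n = descend q E (m + i) n := by
  induction n with
  | zero => rfl
  | succ n ih => rw [descend, descend, ih, crossing, crossing, add_assoc]

theorem around_shift (m i n : ℕ) :
    around q (fun j => E (m + j)) i n = around q E (m + i) n := by
  rw [around, around, ascend_shift, descend_shift]

theorem op_ascend (i n : ℕ) : op (ascend q E i n) = descend q (fun j => op (E j)) i n := by
  induction n with
  | zero => rfl
  | succ n ih => rw [ascend, MulOpposite.op_mul, ih, op_crossing, descend]

theorem op_descend (i n : ℕ) : op (descend q E i n) = ascend q (fun j => op (E j)) i n := by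
  induction n with
  | zero => rfl
  | succ n ih => rw [descend, MulOpposite.op_mul, ih, op_crossing, ascend]

theorem op_around (i n : ℕ) : op (around q E i n) = around q (fun j => op (E j)) i n := by
  rw [around, MulOpposite.op_mul, op_ascend, op_descend, around]

theorem around_succ (i n : ℕ) :
    around q E i (n + 1) = crossing q E (i + n) * around q E i n * crossing q E (i + n) := by
  simp only [around, ascend, descend, mul_assoc]

theorem block_zero_right (m : ℕ) : block q E m 0 = 1 := by
  induction m with
  | zero => rfl
  | succ m ih => rw [block, ih, ascend, mul_one]

theorem twistValue_add_two (n : ℕ) : twistValue q E (n + 2) =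
    twistValue q E n * (around q E 0 n * crossing q E n * around q E 0 n * crossing q E n) := by
  rw [twistValue, twistValue, around_succ, zero_add]
  simp only [mul_assoc]

namespace IsTL

theorem block_succ_right (hE : IsTL δ E) (m n : ℕ) :
    block q E m (n + 1) = block q E m n * descend q E n m := by
  induction m with
  | zero => rw [block, block, descend, one_mul]
  | succ m ih =>
    have h := (hE.commute_strands_crossing (q := q) (block_mem (q := q) m n) le_rfl).eq
    rw [block, block, ih, ascend, descend, add_comm n m]
    simp only [mul_assoc]
    rw [← mul_assoc (crossing q E (m + n)), ← h, mul_assoc]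

theorem semiconjBy_descend (hE : IsTL (loopValue q) E) (hq : q ≠ 0) (n : ℕ) {m i : ℕ}
    (h : i + 1 < m) : SemiconjBy (descend q E n m) (E (n + i + 1)) (E (n + i)) := by
  induction m with
  | zero => omega
  | succ m ih =>
    rcases Nat.lt_or_ge (i + 1) m with h' | h'
    · have hcomm : Commute (E (n + i)) (crossing q E (n + m)) :=
        semiconjBy_crossing (hE.comm (by omega))
      exact SemiconjBy.mul_left hcomm.symm (ih h')
    · obtain rfl : m = i + 1 := by omega
      rw [descend, descend, ← mul_assoc]
      exact SemiconjBy.mul_left (hE.semiconjBy_crossing_mul_crossing hq (.inr rfl))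
        (hE.commute_strands (descend_mem n i) le_rfl)

theorem semiconjBy_ascend (hE : IsTL (loopValue q) E) (hq : q ≠ 0) (m : ℕ) {n i : ℕ}
    (h : i + 1 < n) : SemiconjBy (ascend q E m n) (E (m + i)) (E (m + i + 1)) := by
  induction n with
  | zero => omega
  | succ n ih =>
    rcases Nat.lt_or_ge (i + 1) n with h' | h'
    · have hcomm : Commute (E (m + i)) (crossing q E (m + n)) :=
        semiconjBy_crossing (hE.comm (by omega))
      exact (ih h').mul_left hcomm.symm
    · obtain rfl : n = i + 1 := by omega
      rw [ascend, ascend, mul_assoc]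
      exact SemiconjBy.mul_left (hE.commute_strands (ascend_mem m i) le_rfl)
        (hE.semiconjBy_crossing_mul_crossing hq (.inl rfl))

theorem semiconjBy_block_left (hE : IsTL (loopValue q) E) (hq : q ≠ 0) {m i : ℕ} (n : ℕ)
    (h : i + 1 < m) : SemiconjBy (block q E m n) (E (n + i)) (E i) := by
  induction n with
  | zero =>
    rw [block_zero_right, zero_add]
    exact SemiconjBy.one_left _
  | succ n ih =>
    rw [hE.block_succ_right, add_right_comm]
    exact ih.mul_left (hE.semiconjBy_descend hq n h)

theorem semiconjBy_block_right (hE : IsTL (loopValue q) E) (hq : q ≠ 0) (m : ℕ) {n i : ℕ}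
    (h : i + 1 < n) : SemiconjBy (block q E m n) (E i) (E (m + i)) := by
  induction m with
  | zero =>
    rw [zero_add]
    exact SemiconjBy.one_left _
  | succ m ih =>
    rw [add_right_comm]
    exact SemiconjBy.mul_left (hE.semiconjBy_ascend hq m h) ih

theorem descend_mul_descend_succ (hE : IsTL δ E) (n m : ℕ) :
    descend q E n (m + 1) * descend q E (n + 1) (m + 1) =
      crossing q E (n + m) * crossing q E (n + m + 1) *
        (descend q E n m * descend q E (n + 1) m) := by
  have h := (hE.commute_strands_crossing (q := q) (descend_mem (q := q) n m)
    (le_refl (n + m + 1))).eq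
  rw [descend, descend, add_right_comm n 1 m]
  simp only [mul_assoc]
  rw [← mul_assoc (descend q E n m), h, mul_assoc]

theorem ascend_succ_mul_ascend (hE : IsTL δ E) (n m : ℕ) :
    ascend q E (n + 1) (m + 1) * ascend q E n (m + 1) =
      ascend q E (n + 1) m * ascend q E n m *
        (crossing q E (n + m + 1) * crossing q E (n + m)) :=
  MulOpposite.op_injective (by
    simpa only [MulOpposite.op_mul, op_crossing, op_ascend, op_descend, mul_assoc] using
      hE.op.descend_mul_descend_succ (q := q) n m)

/-- A cap slides across a block of strands and back. -/
theorem cap_mul_around_block (hE : IsTL (loopValue q) E) (hq : q ≠ 0) (n m : ℕ) :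
    E (n + m) * (descend q E n m * descend q E (n + 1) m *
      (ascend q E (n + 1) m * ascend q E n m)) = E (n + m) := by
  induction m with
  | zero => simp only [descend, ascend, mul_one]
  | succ m ih =>
    set U := descend q E n m * descend q E (n + 1) m
    set V := ascend q E (n + 1) m * ascend q E n m
    set c := crossing q E (n + m)
    set d := crossing q E (n + m + 1)
    calc _ = E (n + m + 1) * (c * d) * (U * V) * (d * c) := by
          rw [hE.descend_mul_descend_succ, hE.ascend_succ_mul_ascend]
          simp only [mul_assoc, add_assoc, U, V, c, d]
      _ = E (n + m + 1) * (E (n + m) * (U * V)) * (d * c) := by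
          rw [hE.mul_crossing_mul_crossing hq (.inl rfl)]
          simp only [mul_assoc]
      _ = E (n + m + 1) := by
          rw [ih, mul_assoc, hE.mul_crossing_mul_crossing hq (.inr rfl), ← mul_assoc,
            hE.zigzag (.inr rfl)]

/-- A capped pair of strands can be pulled off the block it encircles. -/
theorem cap_mul_block_mul_block (hE : IsTL (loopValue q) E) (hq : q ≠ 0) (m n : ℕ) :
    E (m + n) * (block q E m (n + 2) * block q E (n + 2) m) =
      E (m + n) * (block q E m n * block q E n m) := by
  have h := (hE.commute_strands (block_mem (q := q) m n) le_rfl).eq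
  calc _ = E (m + n) * block q E m n * (descend q E n m * descend q E (n + 1) m *
        (ascend q E (n + 1) m * ascend q E n m)) * block q E n m := by
        rw [hE.block_succ_right, hE.block_succ_right, block, block]
        simp only [mul_assoc]
    _ = _ := by
        rw [← h, mul_assoc (block q E m n), add_comm m n, hE.cap_mul_around_block hq, add_comm n m,
          h, mul_assoc]

theorem commute_around (hE : IsTL (loopValue q) E) (hq : q ≠ 0) {n i : ℕ} (h : i + 1 < n) :
    Commute (E i) (around q E 0 n) := by
  have hasc := hE.semiconjBy_ascend hq 0 h
  have hdesc := hE.semiconjBy_descend hq 0 h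
  rw [zero_add] at hasc hdesc
  exact (hdesc.mul_left hasc).symm

theorem around_mul_crossing_mul_around_mul (hE : IsTL (loopValue q) E) (hq : q ≠ 0) (n : ℕ) :
    around q E 0 n * crossing q E n * around q E 0 n * E n = (-(q ^ 3)⁻¹) • E n := by
  induction n with
  | zero => simp only [around, ascend, descend, one_mul, mul_one, hE.crossing_mul_self hq]
  | succ n ih =>
    set r := around q E 0 n with hr
    set c := crossing q E n
    set d := crossing q E (n + 1)
    have hrd : r * d = d * r :=
      hE.commute_strands_crossing (around_mem 0 n) (by omega : 0 + n + 1 ≤ n + 1)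
    rw [around_succ, zero_add, ← hr]
    calc _ = c * r * (c * d * c) * r * (c * E (n + 1)) := by simp only [mul_assoc, c, d]
      _ = c * (r * d) * c * (d * r) * (c * E (n + 1)) := by
          rw [hE.crossing_braid hq (.inl rfl)]
          simp only [mul_assoc, c, d]
      _ = c * d * (r * c * r) * (d * c * E (n + 1)) := by
          rw [← hrd, hrd]
          simp only [mul_assoc]
          rw [← mul_assoc r d, hrd, mul_assoc]
      _ = c * d * (r * c * r * E n) * E (n + 1) := by
          rw [hE.crossing_mul_crossing_mul hq (.inr rfl)]
          simp only [mul_assoc]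
      _ = _ := by
          rw [ih, mul_smul_comm, hE.crossing_mul_crossing_mul hq (.inl rfl), smul_mul_assoc,
            hE.zigzag (.inr rfl)]

theorem mul_around_mul_crossing_mul_around (hE : IsTL (loopValue q) E) (hq : q ≠ 0) (n : ℕ) :
    E n * (around q E 0 n * crossing q E n * around q E 0 n) = (-(q ^ 3)⁻¹) • E n :=
  MulOpposite.op_injective (by
    simpa only [MulOpposite.op_mul, MulOpposite.op_smul, op_crossing, op_around, mul_assoc] using
      hE.op.around_mul_crossing_mul_around_mul hq n)

theorem twistValue_mul_cap (hE : IsTL (loopValue q) E) (hq : q ≠ 0) (n : ℕ) :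
    twistValue q E (n + 2) * E n = (q ^ 6)⁻¹ • (twistValue q E n * E n) := by
  rw [twistValue_add_two, mul_assoc, mul_assoc _ (crossing q E n), hE.crossing_mul_self hq,
    mul_smul_comm, hE.around_mul_crossing_mul_around_mul hq, smul_smul, mul_smul_comm]
  congr 1
  field_simp

theorem commute_twistValue (hE : IsTL (loopValue q) E) (hq : q ≠ 0) {n i : ℕ} (h : i + 1 < n) :
    Commute (E i) (twistValue q E n) := by
  induction n with
  | zero => omega
  | succ n ih =>
    rcases Nat.lt_or_ge (i + 1) n with h' | h'
    · exact (ih h').mul_right (hE.commute_around hq h')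
    · obtain rfl : n = i + 1 := by omega
      rw [show i + 1 + 1 = i + 2 from rfl, twistValue_add_two]
      refine (hE.commute_strands (twistValue_mem i) le_rfl).symm.mul_right ?_
      refine Commute.mul_right ?_ (semiconjBy_crossing (Commute.refl _))
      exact (hE.mul_around_mul_crossing_mul_around hq i).trans
        (hE.around_mul_crossing_mul_around_mul hq i).symm

theorem commute_twistValue_strands (hE : IsTL (loopValue q) E) (hq : q ≠ 0) {n : ℕ} {x : B}
    (hx : x ∈ strands F E n) : Commute x (twistValue q E n) :=
  commute_of_mem_strands hx fun _ hi => hE.commute_twistValue hq hi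

end IsTL

end Braid

/-! ### Jones–Wenzl idempotents -/

section JonesWenzl

open MulOpposite (op)

variable {F : Type*} [Field F] {B : Type*} [Ring B] [Algebra F B] {δ q : F} {E : ℕ → B}

/-- The quantum dimensions `Δ_n`, the values at the loop value of the Chebyshev polynomials of
the second kind; they are indexed by the integers so that `Δ_{-1} = 0` is available. -/
def quantumDim (δ : F) (n : ℤ) : F := (Chebyshev.S F n).eval δ

theorem quantumDim_neg_one : quantumDim δ (-1) = 0 := by
  rw [quantumDim, Chebyshev.S_neg_one, eval_zero]

theorem quantumDim_zero : quantumDim δ 0 = 1 := by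
  rw [quantumDim, Chebyshev.S_zero, eval_one]

theorem quantumDim_one : quantumDim δ 1 = δ := by
  rw [quantumDim, Chebyshev.S_one, eval_X]

theorem quantumDim_add_one (n : ℤ) :
    quantumDim δ (n + 1) = δ * quantumDim δ n - quantumDim δ (n - 1) := by
  rw [quantumDim, Chebyshev.S_add_one, eval_sub, eval_mul, eval_X, quantumDim, quantumDim]

/-- Loop values for which all Jones–Wenzl idempotents are defined. -/
def IsGeneric (δ : F) : Prop := ∀ n : ℕ, quantumDim δ n ≠ 0

theorem IsGeneric.ne_zero (hδ : IsGeneric δ) : δ ≠ 0 := by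
  simpa only [Nat.cast_one, quantumDim_one] using hδ 1

variable (δ) in
/-- The Jones–Wenzl idempotents, by Wenzl's recursion. At `n = 0` the truncated index `n - 1` is
harmless, because there the coefficient `Δ_{-1} / Δ_0` vanishes. -/
def jonesWenzl (E : ℕ → B) : ℕ → B
  | 0 => 1
  | n + 1 => jonesWenzl E n - (quantumDim δ (n - 1) / quantumDim δ n) •
      (jonesWenzl E n * E (n - 1) * jonesWenzl E n)

theorem jonesWenzl_one : jonesWenzl δ E 1 = 1 := by
  simp [jonesWenzl, quantumDim_neg_one]

theorem jonesWenzl_add_two (n : ℕ) : jonesWenzl δ E (n + 2) = jonesWenzl δ E (n + 1) -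
    (quantumDim δ n / quantumDim δ (n + 1)) •
      (jonesWenzl δ E (n + 1) * E n * jonesWenzl δ E (n + 1)) := by
  rw [jonesWenzl, Nat.add_sub_cancel, Nat.cast_add_one, add_sub_cancel_right]

theorem jonesWenzl_mem (n : ℕ) : jonesWenzl δ E n ∈ strands F E n := by
  induction n using Nat.twoStepInduction with
  | zero => exact one_mem _
  | one => exact jonesWenzl_one (δ := δ) (E := E) ▸ one_mem _
  | more n _ ih =>
    have ih' := strands_mono (n + 1).le_succ ih
    rw [jonesWenzl_add_two]
    exact sub_mem ih' (Subalgebra.smul_mem _ (mul_mem (mul_mem ih' (mem_strands (by omega))) ih') _)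

theorem semiconjBy_jonesWenzl {E' : ℕ → B} {b : B} {n : ℕ}
    (h : ∀ i, i + 1 < n → SemiconjBy b (E i) (E' i)) :
    SemiconjBy b (jonesWenzl δ E n) (jonesWenzl δ E' n) := by
  induction n using Nat.twoStepInduction with
  | zero => exact SemiconjBy.one_right _
  | one => simpa only [jonesWenzl_one] using SemiconjBy.one_right _
  | more n _ ih =>
    have ih' := ih fun i hi => h i (by omega)
    rw [jonesWenzl_add_two, jonesWenzl_add_two]
    exact ih'.sub_right (((ih'.mul_right (h n (by omega))).mul_right ih').smul_right _)

theorem op_jonesWenzl (n : ℕ) :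
    op (jonesWenzl δ E n) = jonesWenzl δ (fun i => op (E i)) n := by
  induction n with
  | zero => rfl
  | succ n ih =>
    rw [jonesWenzl, jonesWenzl, ← ih, MulOpposite.op_sub, MulOpposite.op_smul, MulOpposite.op_mul,
      MulOpposite.op_mul, mul_assoc]

theorem loop_sub_quantumDim_div (hδ : IsGeneric δ) (n : ℕ) :
    δ - quantumDim δ (n - 1) / quantumDim δ n = quantumDim δ (n + 1) / quantumDim δ n := by
  rw [quantumDim_add_one, sub_div, mul_div_cancel_right₀ _ (hδ n)]

namespace IsTL

theorem commute_jonesWenzl (hE : IsTL δ E) (n : ℕ) : Commute (jonesWenzl δ E n) (E n) :=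
  hE.commute_strands (jonesWenzl_mem n) le_rfl

theorem cap_mul_cap_mul_cap (hE : IsTL δ E) {n : ℕ} {x y : B} (hx : x ∈ strands F E (n + 1))
    (hy : y ∈ strands F E (n + 1)) : E (n + 1) * (x * E n * y) * E (n + 1) = x * y * E (n + 1) := by
  calc E (n + 1) * (x * E n * y) * E (n + 1)
      = E (n + 1) * x * E n * (y * E (n + 1)) := by simp only [mul_assoc]
    _ = x * E (n + 1) * E n * (E (n + 1) * y) := by
      rw [(hE.commute_strands hx le_rfl).eq, (hE.commute_strands hy le_rfl).eq]
    _ = x * (E (n + 1) * E n * E (n + 1)) * y := by simp only [mul_assoc]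
    _ = x * y * E (n + 1) := by
      rw [hE.zigzag (by omega), mul_assoc, mul_assoc, (hE.commute_strands hy le_rfl).eq]

theorem cap_jonesWenzl_cap_of_idem (hE : IsTL δ E) (hδ : IsGeneric δ) {n : ℕ}
    (h : IsIdempotentElem (jonesWenzl δ E n)) :
    E n * jonesWenzl δ E (n + 1) * E n =
      (quantumDim δ (n + 1) / quantumDim δ n) • (jonesWenzl δ E n * E n) := by
  have hc := (hE.commute_jonesWenzl n).eq
  cases n with
  | zero => simp [jonesWenzl, quantumDim_neg_one, quantumDim_one, quantumDim_zero, hE.sq]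
  | succ n =>
    set p := jonesWenzl δ E (n + 1)
    have hp : p ∈ strands F E (n + 1) := jonesWenzl_mem (n + 1)
    have hcap : E (n + 1) * (p * E n * p) * E (n + 1) = p * E (n + 1) := by
      rw [hE.cap_mul_cap_mul_cap hp hp, h.eq]
    rw [← loop_sub_quantumDim_div hδ, jonesWenzl, mul_sub, sub_mul, ← hc, mul_assoc, hE.sq,
      mul_smul_comm, mul_smul_comm, smul_mul_assoc, sub_smul, Nat.add_sub_cancel, hcap]

theorem jonesWenzl_idem_and_cap_mul (hE : IsTL δ E) (hδ : IsGeneric δ) (n : ℕ) :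
    IsIdempotentElem (jonesWenzl δ E n) ∧ ∀ i, i + 1 < n → E i * jonesWenzl δ E n = 0 := by
  induction n using Nat.twoStepInduction with
  | zero => exact ⟨IsIdempotentElem.one, fun i hi => by omega⟩
  | one => exact ⟨jonesWenzl_one (δ := δ) (E := E) ▸ IsIdempotentElem.one, fun i hi => by omega⟩
  | more n ih₀ ih₁ =>
    obtain ⟨hidem₀, -⟩ := ih₀
    obtain ⟨hidem, hkill⟩ := ih₁
    have hcap := hE.cap_jonesWenzl_cap_of_idem hδ hidem₀
    set c := quantumDim δ n / quantumDim δ (n + 1) with hc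
    have hrec := jonesWenzl_add_two (δ := δ) (E := E) n
    have habsorb : jonesWenzl δ E n * jonesWenzl δ E (n + 1) = jonesWenzl δ E (n + 1) := by
      rw [jonesWenzl, mul_sub, mul_smul_comm, ← mul_assoc, ← mul_assoc, hidem₀.eq]
    have hlast : E n * jonesWenzl δ E (n + 2) = 0 := by
      have hone : c * (quantumDim δ (n + 1) / quantumDim δ n) = 1 := by
        rw [hc, div_mul_div_cancel₀ (mod_cast hδ (n + 1)), div_self (hδ n)]
      rw [hrec, mul_sub, mul_smul_comm, ← mul_assoc, ← mul_assoc, hcap, smul_mul_assoc, smul_smul,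
        hone, one_smul, (hE.commute_jonesWenzl n).eq, mul_assoc, habsorb, sub_self]
    have hkill' (i : ℕ) (hi : i + 1 < n + 2) : E i * jonesWenzl δ E (n + 2) = 0 := by
      obtain hi | hi := (Nat.le_of_lt_succ hi).lt_or_eq
      · rw [hrec, mul_sub, mul_smul_comm, ← mul_assoc, ← mul_assoc, hkill i hi, zero_mul, zero_mul,
          smul_zero, sub_zero]
      · rwa [show i = n by omega]
    refine ⟨?_, hkill'⟩
    have habsorb' : jonesWenzl δ E (n + 1) * jonesWenzl δ E (n + 2) = jonesWenzl δ E (n + 2) := by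
      rw [hrec, mul_sub, mul_smul_comm, ← mul_assoc, ← mul_assoc, hidem.eq]
    rw [IsIdempotentElem]
    nth_rw 1 [hrec]
    rw [sub_mul, smul_mul_assoc, mul_assoc (_ * _), habsorb', mul_assoc, hlast, mul_zero, smul_zero,
      sub_zero]

theorem isIdempotentElem_jonesWenzl (hE : IsTL δ E) (hδ : IsGeneric δ) (n : ℕ) :
    IsIdempotentElem (jonesWenzl δ E n) :=
  (hE.jonesWenzl_idem_and_cap_mul hδ n).1

theorem cap_mul_jonesWenzl (hE : IsTL δ E) (hδ : IsGeneric δ) {i n : ℕ} (h : i + 1 < n) :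
    E i * jonesWenzl δ E n = 0 :=
  (hE.jonesWenzl_idem_and_cap_mul hδ n).2 i h

theorem jonesWenzl_mul_cap (hE : IsTL δ E) (hδ : IsGeneric δ) {i n : ℕ} (h : i + 1 < n) :
    jonesWenzl δ E n * E i = 0 :=
  MulOpposite.op_injective (by
    rw [MulOpposite.op_mul, op_jonesWenzl, hE.op.cap_mul_jonesWenzl hδ h, MulOpposite.op_zero])

theorem cap_jonesWenzl_cap (hE : IsTL δ E) (hδ : IsGeneric δ) (n : ℕ) :
    E n * jonesWenzl δ E (n + 1) * E n =
      (quantumDim δ (n + 1) / quantumDim δ n) • (jonesWenzl δ E n * E n) :=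
  hE.cap_jonesWenzl_cap_of_idem hδ (hE.isIdempotentElem_jonesWenzl hδ n)

theorem commute_strands_jonesWenzl (hE : IsTL δ E) (hδ : IsGeneric δ) {n : ℕ} {x : B}
    (hx : x ∈ strands F E n) : Commute x (jonesWenzl δ E n) :=
  commute_of_mem_strands hx fun _ hi =>
    (hE.cap_mul_jonesWenzl hδ hi).trans (hE.jonesWenzl_mul_cap hδ hi).symm

theorem jonesWenzl_succ_mul (hE : IsTL δ E) (hδ : IsGeneric δ) (n : ℕ) :
    jonesWenzl δ E (n + 1) * jonesWenzl δ E n = jonesWenzl δ E (n + 1) := by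
  rw [jonesWenzl, sub_mul, smul_mul_assoc, mul_assoc _ (jonesWenzl δ E n) (jonesWenzl δ E n),
    (hE.isIdempotentElem_jonesWenzl hδ n).eq]

theorem crossing_mul_jonesWenzl (hE : IsTL δ E) (hδ : IsGeneric δ) {i n : ℕ} (h : i + 1 < n) :
    crossing q E i * jonesWenzl δ E n = q • jonesWenzl δ E n := by
  rw [crossing, add_mul, smul_mul_assoc, smul_mul_assoc, hE.cap_mul_jonesWenzl hδ h, one_mul,
    smul_zero, add_zero]

theorem around_mul_jonesWenzl (hE : IsTL δ E) (hδ : IsGeneric δ) {n N : ℕ} (h : n + 1 ≤ N) :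
    around q E 0 n * jonesWenzl δ E N = q ^ (2 * n) • jonesWenzl δ E N := by
  induction n with
  | zero => simp [around, ascend, descend]
  | succ n ih =>
    rw [around_succ, zero_add, mul_assoc, hE.crossing_mul_jonesWenzl hδ (by omega), mul_smul_comm,
      mul_assoc, ih (by omega), mul_smul_comm, hE.crossing_mul_jonesWenzl hδ (by omega), smul_smul,
      smul_smul]
    congr 1
    ring

theorem twistValue_mul_jonesWenzl (hE : IsTL δ E) (hδ : IsGeneric δ) {n N : ℕ} (h : n ≤ N) :
    twistValue q E n * jonesWenzl δ E N = q ^ (n * (n - 1)) • jonesWenzl δ E N := by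
  induction n with
  | zero => simp [twistValue]
  | succ n ih =>
    rw [twistValue, mul_assoc, hE.around_mul_jonesWenzl hδ h, mul_smul_comm, ih (by omega),
      smul_smul, ← pow_add]
    congr 2
    cases n with
    | zero => rfl
    | succ n =>
      simp only [Nat.add_sub_cancel]
      ring

theorem jonesWenzl_mul_around (hE : IsTL δ E) (hδ : IsGeneric δ) (n : ℕ) :
    jonesWenzl δ E (n + 1) * around q E 0 n = q ^ (2 * n) • jonesWenzl δ E (n + 1) := by
  have haround : around q E 0 n ∈ strands F E (n + 1) := by simpa using around_mem 0 n
  rw [← (hE.commute_strands_jonesWenzl hδ haround).eq, hE.around_mul_jonesWenzl hδ le_rfl]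

/-- The induction resolves the two outermost crossings of the last strand; of the four resulting
terms one contains the previous case and the others are straightened by a zigzag. -/
theorem cap_jonesWenzl_mul_around_cap (hE : IsTL (loopValue q) E) (hδ : IsGeneric (loopValue q))
    (hq : q ≠ 0) (n : ℕ) :
    E n * (jonesWenzl (loopValue q) E n * around q E 0 n) * E n =
      loopValue (q ^ (n + 1)) • (jonesWenzl (loopValue q) E n * E n) := by
  induction n with
  | zero => simp [jonesWenzl, around, ascend, descend, hE.sq]
  | succ n ih =>
    set p := jonesWenzl (loopValue q) E (n + 1) with hp
    set x := around q E 0 n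
    have hmem : p ∈ strands F E (n + 1) := jonesWenzl_mem (n + 1)
    have hx : x ∈ strands F E (n + 1) := by simpa using around_mem (q := q) (E := E) 0 n
    have hpx : p * x = q ^ (2 * n) • p := hE.jonesWenzl_mul_around hδ n
    have hstraight : E (n + 1) * (p * x) * E (n + 1) =
        (q ^ (2 * n) * loopValue q) • (p * E (n + 1)) := by
      rw [hpx, mul_smul_comm, smul_mul_assoc, ← (hE.commute_strands hmem le_rfl).eq, mul_assoc,
        hE.sq, mul_smul_comm, smul_smul]
    have hright : E (n + 1) * (p * (x * E n)) * E (n + 1) = q ^ (2 * n) • (p * E (n + 1)) := by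
      have h := hE.cap_mul_cap_mul_cap (mul_mem hmem hx) (one_mem _)
      rwa [mul_one, mul_one, mul_assoc p, hpx, smul_mul_assoc] at h
    have hleft : E (n + 1) * (p * (E n * x)) * E (n + 1) = q ^ (2 * n) • (p * E (n + 1)) := by
      rw [← mul_assoc p, hE.cap_mul_cap_mul_cap hmem hx, hpx, smul_mul_assoc]
    have hboth : E (n + 1) * (p * (E n * x * E n)) * E (n + 1) =
        loopValue (q ^ (n + 1)) • (p * E (n + 1)) := by
      have hcap : p * (E n * x * E n) = loopValue (q ^ (n + 1)) • (p * E n) := by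
        rw [hp, ← hE.jonesWenzl_succ_mul hδ, mul_assoc, ← mul_assoc _ (E n * x),
          ← mul_assoc _ (E n) x, (hE.commute_jonesWenzl n).eq, mul_assoc (E n), ih, mul_smul_comm,
          mul_assoc]
      simpa only [hcap, mul_one, mul_smul_comm, smul_mul_assoc] using
        congrArg (loopValue (q ^ (n + 1)) • ·) (hE.cap_mul_cap_mul_cap hmem (one_mem _))
    have hresolve : around q E 0 (n + 1) =
        q ^ 2 • x + x * E n + E n * x + (q⁻¹) ^ 2 • (E n * x * E n) := by
      rw [around_succ, zero_add, crossing_mul_mul_crossing hq]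
    rw [hresolve]
    simp only [mul_add, add_mul, mul_smul_comm, smul_mul_assoc]
    rw [hstraight, hright, hleft, hboth]
    simp only [smul_smul, ← add_smul]
    congr 1
    simp only [loopValue]
    field_simp
    ring

end IsTL

end JonesWenzl

/-! ### Functionals on the annulus -/

section Annular

variable {F : Type*} [Field F] {B : Type*} [Ring B] [Algebra F B] {δ q : F} {E : ℕ → B}

/-- Functionals on diagrams in the annulus, one for each number of strands: they are traces, and
a closed strand with a turn-back across it retracts to leave a circle of value `δ`. -/
structure IsAnnular (δ : F) (E : ℕ → B) (Φ : ℕ → B →ₗ[F] F) : Prop where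
  mul_comm {n : ℕ} {x y : B} (_ : x ∈ strands F E n) (_ : y ∈ strands F E n) :
    Φ n (x * y) = Φ n (y * x)
  cap {n : ℕ} {x : B} (_ : x ∈ strands F E n) : Φ (n + 2) (x * E n) = δ * Φ n x

namespace IsAnnular

variable {Φ : ℕ → B →ₗ[F] F}

theorem apply_mul_cap (hΦ : IsAnnular δ E Φ) (hE : IsTL δ E) {i j N : ℕ}
    (hij : i + 1 = j ∨ j + 1 = i) (hi : i + 1 < N) (hj : j + 1 < N) {x : B}
    (hx : x ∈ strands F E N) (hc : Commute x (E i)) :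
    Φ N (x * E i) = δ * Φ N (x * E i * E j) := by
  have hi := mem_strands (F := F) (E := E) hi
  have hj := mem_strands (F := F) (E := E) hj
  calc Φ N (x * E i) = Φ N (x * E i * E j * E i) := by
        rw [mul_assoc, mul_assoc, ← mul_assoc (E i), hE.zigzag hij]
    _ = Φ N (E i * (x * E i * E j)) := hΦ.mul_comm (mul_mem (mul_mem hx hi) hj) hi
    _ = δ * Φ N (x * E i * E j) := by
        rw [← mul_assoc, ← mul_assoc, ← hc.eq, mul_assoc x, hE.sq, mul_smul_comm, smul_mul_assoc,
          map_smul, smul_eq_mul]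

theorem apply_mul_cap_succ (hΦ : IsAnnular δ E Φ) (hE : IsTL δ E) {n N : ℕ} (hN : n + 2 < N)
    {x : B} (hx : x ∈ strands F E n) : Φ N (x * E n) = Φ N (x * E (n + 1)) := by
  have hx' : x ∈ strands F E N := strands_mono (by omega) hx
  have hc := hE.commute_strands hx le_rfl
  have hn : E n ∈ strands F E N := mem_strands (by omega)
  have hn' : E (n + 1) ∈ strands F E N := mem_strands (by omega)
  rw [hΦ.apply_mul_cap hE (.inl rfl) (by omega) hN hx' hc,
    hΦ.apply_mul_cap hE (.inr rfl) hN (by omega) hx' (hE.commute_strands hx n.le_succ),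
    hΦ.mul_comm (mul_mem hx' hn') hn, ← mul_assoc, hc.eq]

theorem cap_of_le (hΦ : IsAnnular δ E Φ) (hE : IsTL δ E) {n N : ℕ} (h : n ≤ N) {x : B}
    (hx : x ∈ strands F E n) : Φ (N + 2) (x * E n) = δ * Φ N x := by
  induction h using Nat.decreasingInduction with
  | self => exact hΦ.cap hx
  | of_succ n h ih =>
    rw [hΦ.apply_mul_cap_succ hE (by omega) hx, ih (strands_mono n.le_succ hx)]

theorem apply_jonesWenzl_cap_jonesWenzl (hΦ : IsAnnular δ E Φ) (hE : IsTL δ E)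
    (hδ : IsGeneric δ) {n N : ℕ} (h : n ≤ N) :
    Φ (N + 2) (jonesWenzl δ E (n + 1) * E n * jonesWenzl δ E (n + 1)) =
      quantumDim δ (n + 1) / quantumDim δ n * Φ N (jonesWenzl δ E n) := by
  have hp : jonesWenzl δ E (n + 1) ∈ strands F E (N + 2) :=
    strands_mono (by omega) (jonesWenzl_mem _)
  have hcap : E n ∈ strands F E (N + 2) := mem_strands (by omega)
  refine mul_left_cancel₀ hδ.ne_zero ?_
  calc δ * Φ (N + 2) (jonesWenzl δ E (n + 1) * E n * jonesWenzl δ E (n + 1))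
      = δ * Φ (N + 2) (jonesWenzl δ E (n + 1) * E n) := by
        rw [hΦ.mul_comm (mul_mem hp hcap) hp, ← mul_assoc,
          (hE.isIdempotentElem_jonesWenzl hδ (n + 1)).eq]
    _ = Φ (N + 2) (E n * jonesWenzl δ E (n + 1) * E n) := by
        rw [mul_assoc, hΦ.mul_comm hcap (mul_mem hp hcap), mul_assoc, hE.sq, mul_smul_comm,
          map_smul, smul_eq_mul]
    _ = δ * (quantumDim δ (n + 1) / quantumDim δ n * Φ N (jonesWenzl δ E n)) := by
        rw [hE.cap_jonesWenzl_cap hδ, map_smul, smul_eq_mul, hΦ.cap_of_le hE h (jonesWenzl_mem n),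
          mul_left_comm]

theorem apply_jonesWenzl_add_two (hΦ : IsAnnular δ E Φ) (hE : IsTL δ E) (hδ : IsGeneric δ)
    {n N : ℕ} (h : n ≤ N) : Φ (N + 2) (jonesWenzl δ E (n + 2)) =
      Φ (N + 2) (jonesWenzl δ E (n + 1)) - Φ N (jonesWenzl δ E n) := by
  rw [jonesWenzl_add_two, map_sub, map_smul, hΦ.apply_jonesWenzl_cap_jonesWenzl hE hδ h,
    smul_eq_mul, ← mul_assoc, div_mul_div_cancel₀ (mod_cast hδ (n + 1)), div_self (hδ n), one_mul]

/-- On the annulus the closure of a Jones–Wenzl idempotent is a Chebyshev polynomial of the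
core. -/
theorem apply_X_pow_mul_chebyshev {R : Type*} [CommRing R] [Algebra R F] (hΦ : IsAnnular δ E Φ)
    (hE : IsTL δ E) (hδ : IsGeneric δ) {L : R[X] →ₗ[R] F} (hL : ∀ k, L (X ^ k) = Φ k 1)
    (k n : ℕ) : L (X ^ k * Chebyshev.S R n) = Φ (n + k) (jonesWenzl δ E n) := by
  induction n using Nat.twoStepInduction generalizing k with
  | zero => rw [Nat.cast_zero, Chebyshev.S_zero, mul_one, hL, zero_add, jonesWenzl]
  | one => rw [Nat.cast_one, Chebyshev.S_one, ← pow_succ, hL, jonesWenzl_one, add_comm]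
  | more n ih₀ ih₁ =>
    rw [Nat.cast_add, Nat.cast_two, Chebyshev.S_add_two, mul_sub, ← mul_assoc, ← pow_succ,
      map_sub, ← Nat.cast_add_one, ih₁, ih₀, show n + 2 + k = n + k + 2 by omega,
      hΦ.apply_jonesWenzl_add_two hE hδ (Nat.le_add_right n k),
      show n + 1 + (k + 1) = n + k + 2 by omega]

end IsAnnular

variable (q E) in
/-- The closure, with respect to the Markov trace `τ`, of `n` strands with a framed full twist as
a functional on the annulus; the factor `(-q³)ⁿ` is the framing of the strands. -/
def twistFunctional (τ : B →ₗ[F] F) (n : ℕ) : B →ₗ[F] F :=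
  (loopValue q ^ n * (-q ^ 3) ^ n) • (τ ∘ₗ LinearMap.mulLeft F (twistValue q E n))

theorem twistFunctional_apply (τ : B →ₗ[F] F) (n : ℕ) (x : B) : twistFunctional q E τ n x =
    loopValue q ^ n * (-q ^ 3) ^ n * τ (twistValue q E n * x) := rfl

variable (q E) in
/-- The closure, with respect to the Markov trace `τ`, of `n` strands encircled by `m` strands as a
functional on the annulus; the `n` strands stand to the right of the `m` strands. -/
def hopfFunctional (τ : B →ₗ[F] F) (m n : ℕ) : B →ₗ[F] F :=
  loopValue q ^ (m + n) • (τ ∘ₗ LinearMap.mulRight F (block q E m n * block q E n m))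

theorem hopfFunctional_apply (τ : B →ₗ[F] F) (m n : ℕ) (x : B) : hopfFunctional q E τ m n x =
    loopValue q ^ (m + n) * τ (x * (block q E m n * block q E n m)) := rfl

theorem strands_shift_le (m n : ℕ) : strands F (fun i => E (m + i)) n ≤ strands F E (m + n) := by
  refine Algebra.adjoin_mono ?_
  rintro _ ⟨i, hi, rfl⟩
  exact ⟨m + i, by omega, rfl⟩

theorem block_mul_block_mem (m n : ℕ) :
    block q E m n * block q E n m ∈ strands F E (m + n) :=
  mul_mem (block_mem m n) (add_comm m n ▸ block_mem n m)

namespace IsMarkov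

variable {τ : B →ₗ[F] F}

theorem trace_cap_mul_mul_cap (hτ : IsMarkov δ E τ) (hE : IsTL δ E) {n : ℕ} {x : B}
    (hx : x ∈ strands F E (n + 1)) : τ (E n * x * E n) = τ x := by
  rw [mul_assoc, hτ.mul_comm, mul_assoc, hE.sq, mul_smul_comm, map_smul, smul_eq_mul,
    hτ.markov hx]

theorem trace_jonesWenzl (hτ : IsMarkov δ E τ) (hE : IsTL δ E) (hδ : IsGeneric δ) (n : ℕ) :
    δ ^ n * τ (jonesWenzl δ E n) = quantumDim δ n := by
  induction n with
  | zero => simp [jonesWenzl, hτ.one, quantumDim_zero]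
  | succ n ih =>
    have hstep : δ * τ (jonesWenzl δ E (n + 1)) =
        quantumDim δ (n + 1) / quantumDim δ n * τ (jonesWenzl δ E n) := by
      rw [← hτ.trace_cap_mul_mul_cap hE (jonesWenzl_mem (n + 1)), hE.cap_jonesWenzl_cap hδ,
        map_smul, smul_eq_mul, mul_left_comm,
        hτ.markov (strands_mono n.le_succ (jonesWenzl_mem n))]
    rw [pow_succ, mul_assoc, hstep, mul_left_comm, ih, div_mul_cancel₀ _ (hδ n), Nat.cast_add_one]

theorem isAnnular_twistFunctional (hτ : IsMarkov (loopValue q) E τ) (hE : IsTL (loopValue q) E)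
    (hq : q ≠ 0) : IsAnnular (loopValue q) E (twistFunctional q E τ) where
  mul_comm {n x y} hx _ := by
    have h : τ (twistValue q E n * (x * y)) = τ (twistValue q E n * (y * x)) := by
      rw [← mul_assoc, ← (hE.commute_twistValue_strands hq hx).eq, mul_assoc, hτ.mul_comm,
        mul_assoc]
    rw [twistFunctional_apply, twistFunctional_apply, h]
  cap {n x} hx := by
    have hmem : twistValue q E n * x ∈ strands F E (n + 1) :=
      strands_mono n.le_succ (mul_mem (twistValue_mem n) hx)
    have hc := (hE.commute_strands hx le_rfl).eq
    have hcap : loopValue q * τ (twistValue q E (n + 2) * (x * E n)) =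
        (q ^ 6)⁻¹ * τ (twistValue q E n * x) := by
      rw [hc, ← mul_assoc, hE.twistValue_mul_cap hq, smul_mul_assoc, map_smul, smul_eq_mul,
        mul_assoc, ← hc, mul_left_comm, ← mul_assoc (twistValue q E n), hτ.markov hmem]
    calc twistFunctional q E τ (n + 2) (x * E n)
        = loopValue q ^ (n + 1) * (-q ^ 3) ^ (n + 2) *
            (loopValue q * τ (twistValue q E (n + 2) * (x * E n))) := by
          rw [twistFunctional_apply]
          ring
      _ = loopValue q * twistFunctional q E τ n x := by
          rw [hcap, twistFunctional_apply]
          field_simp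
          ring

theorem twistFunctional_jonesWenzl (hτ : IsMarkov (loopValue q) E τ)
    (hE : IsTL (loopValue q) E) (hδ : IsGeneric (loopValue q)) (n : ℕ) :
    twistFunctional q E τ n (jonesWenzl (loopValue q) E n) =
      (-1) ^ n * q ^ (n ^ 2 + 2 * n) * quantumDim (loopValue q) n := by
  have hexp : 3 * n + n * (n - 1) = n ^ 2 + 2 * n := by
    cases n with
    | zero => rfl
    | succ n =>
      rw [Nat.add_sub_cancel]
      ring
  rw [twistFunctional_apply, hE.twistValue_mul_jonesWenzl hδ le_rfl, map_smul, smul_eq_mul,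
    ← hτ.trace_jonesWenzl hE hδ, neg_pow, ← pow_mul, ← hexp, pow_add]
  ring

theorem isAnnular_hopfFunctional (hτ : IsMarkov (loopValue q) E τ)
    (hE : IsTL (loopValue q) E) (hq : q ≠ 0) (m : ℕ) :
    IsAnnular (loopValue q) (fun i => E (m + i)) (hopfFunctional q E τ m) where
  mul_comm {n x y} _ hy := by
    have hc : Commute y (block q E m n * block q E n m) :=
      commute_of_mem_strands hy fun i hi =>
        ((hE.semiconjBy_block_right hq m hi).mul_left (hE.semiconjBy_block_left hq m hi)).symm
    rw [hopfFunctional_apply, hopfFunctional_apply, mul_assoc, hc.eq, ← mul_assoc, hτ.mul_comm,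
      ← mul_assoc]
  cap {n x} hx := by
    have hb := block_mul_block_mem (F := F) (q := q) (E := E) m n
    have hc := (hE.commute_strands hb le_rfl).eq
    have hxb := strands_mono (m + n).le_succ (mul_mem (strands_shift_le m n hx) hb)
    rw [hopfFunctional_apply, hopfFunctional_apply, mul_assoc, hE.cap_mul_block_mul_block hq, ← hc,
      ← mul_assoc, ← hτ.markov hxb]
    ring

theorem trace_mul_jonesWenzl_mul_around (hτ : IsMarkov (loopValue q) E τ)
    (hE : IsTL (loopValue q) E) (hδ : IsGeneric (loopValue q)) (hq : q ≠ 0) {m n : ℕ} {y : B}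
    (hy : y ∈ strands F E (m + n)) :
    loopValue q * τ (y * (jonesWenzl (loopValue q) (fun i => E (m + i)) n * around q E m n)) =
      loopValue (q ^ (n + 1)) * τ (y * jonesWenzl (loopValue q) (fun i => E (m + i)) n) := by
  set p := jonesWenzl (loopValue q) (fun i => E (m + i)) n with hp
  have hcap := (hE.shift m).cap_jonesWenzl_mul_around_cap hδ hq n
  rw [around_shift, add_zero, ← hp] at hcap
  have hpm : p ∈ strands F E (m + n) := strands_shift_le m n (jonesWenzl_mem n)
  have hm : strands F E (m + n) ≤ strands F E (m + n + 1) := strands_mono (m + n).le_succ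
  have hyE := (hE.commute_strands hy le_rfl).eq
  calc loopValue q * τ (y * (p * around q E m n))
      = loopValue q * τ (y * (E (m + n) * (p * around q E m n) * E (m + n))) := by
        rw [← hτ.trace_cap_mul_mul_cap hE
          (mul_mem (hm hy) (mul_mem (hm hpm) (around_mem m n))), ← mul_assoc (E (m + n)), ← hyE]
        simp only [mul_assoc]
    _ = loopValue (q ^ (n + 1)) * τ (y * p) := by
        rw [hcap, mul_smul_comm, map_smul, smul_eq_mul, ← mul_assoc y p, mul_left_comm,
          hτ.markov (hm (mul_mem hy hpm))]

theorem hopfFunctional_jonesWenzl (hτ : IsMarkov (loopValue q) E τ) (hE : IsTL (loopValue q) E)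
    (hδ : IsGeneric (loopValue q)) (hq : q ≠ 0) (m n : ℕ) :
    hopfFunctional q E τ m n (jonesWenzl (loopValue q) (fun i => E (m + i)) n) =
      loopValue (q ^ (n + 1)) ^ m * quantumDim (loopValue q) n := by
  have hmove (m : ℕ) := semiconjBy_jonesWenzl (δ := loopValue q) fun i hi =>
    hE.semiconjBy_block_left hq (i := i) (m := n) m hi
  induction m with
  | zero => simp [hopfFunctional_apply, block_zero_right, block, hτ.trace_jonesWenzl hE hδ]
  | succ m ih =>
    set p := jonesWenzl (loopValue q) (fun i => E (m + i)) n with hp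
    have hpeel : τ (jonesWenzl (loopValue q) (fun i => E (m + 1 + i)) n *
        (block q E (m + 1) n * block q E n (m + 1))) =
        τ (block q E m n * block q E n m * (p * around q E m n)) := by
      rw [← mul_assoc, hτ.mul_comm, ← mul_assoc, (hmove (m + 1)).eq, hE.block_succ_right,
        ← mul_assoc, ← (hmove m).eq, block, around, ← mul_assoc, hτ.mul_comm]
      simp only [mul_assoc, ← hp]
    calc hopfFunctional q E τ (m + 1) n (jonesWenzl (loopValue q) (fun i => E (m + 1 + i)) n)
        = loopValue q ^ (m + n) *
            (loopValue q * τ (block q E m n * block q E n m * (p * around q E m n))) := by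
          rw [hopfFunctional_apply, hpeel]
          ring
      _ = loopValue (q ^ (n + 1)) * hopfFunctional q E τ m n p := by
          rw [hτ.trace_mul_jonesWenzl_mul_around hE hδ hq (block_mul_block_mem m n),
            hopfFunctional_apply, hτ.mul_comm p, mul_left_comm]
      _ = loopValue (q ^ (n + 1)) ^ (m + 1) * quantumDim (loopValue q) n := by
          rw [ih, pow_succ' (loopValue _), mul_assoc]

end IsMarkov

end Annular

/-! ### Evaluation of diagrams -/

section Diagrams

variable {F : Type*} [Field F] {B : Type*} [Ring B] [Algebra F B] {q : F} {E : ℕ → B}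

variable (q E) in
/-- The value of an elementary piece in an algebra containing the turn-backs `E`; the factor `-q³`
of a curl is the value of its resolution. -/
def pieceValue : Piece → B
  | Piece.cross i => crossing q E i
  | Piece.curl _ => (-q ^ 3) • 1

variable (q E) in
/-- The value of a braid-like diagram in an algebra containing the turn-backs `E`. -/
def braidValue (D : List Piece) : B := (D.map (pieceValue q E)).prod

theorem braidValue_nil : braidValue q E [] = 1 := List.prod_nil

theorem braidValue_cons (p : Piece) (D : List Piece) :
    braidValue q E (p :: D) = pieceValue q E p * braidValue q E D := by
  rw [braidValue, List.map_cons, List.prod_cons, braidValue]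

theorem braidValue_append (D D' : List Piece) :
    braidValue q E (D ++ D') = braidValue q E D * braidValue q E D' := by
  rw [braidValue, List.map_append, List.prod_append, braidValue, braidValue]

theorem braidValue_cross (i : ℕ) : braidValue q E [Piece.cross i] = crossing q E i := by
  rw [braidValue_cons, braidValue_nil, mul_one, pieceValue]

theorem braidValue_passRight (i n : ℕ) : braidValue q E (passRight i n) = ascend q E i n := by
  induction n with
  | zero => exact braidValue_nil
  | succ n ih =>
    rw [passRight, List.range_succ, List.map_append, braidValue_append, ← passRight, ih,
      List.map_singleton, braidValue_cross, ascend]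

theorem braidValue_blockCross (m n : ℕ) : braidValue q E (blockCross m n) = block q E m n := by
  induction m with
  | zero => exact braidValue_nil
  | succ m ih =>
    rw [blockCross, List.range_succ, List.reverse_append, List.map_append, List.flatten_append,
      braidValue_append, ← blockCross, ih, block, ← braidValue_passRight]
    simp

theorem braidValue_runAround (n : ℕ) : braidValue q E (runAround n) = around q E 0 n := by
  have hdescend : braidValue q E ((List.range n).reverse.map Piece.cross) = descend q E 0 n := by
    induction n with
    | zero => exact braidValue_nil
    | succ n ih =>
      rw [List.range_succ, List.reverse_append, List.map_append, braidValue_append, ih, descend,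
        zero_add, List.reverse_singleton, List.map_singleton, braidValue_cross]
  rw [runAround, braidValue_append, hdescend, around, ← braidValue_passRight]
  simp only [passRight, zero_add]

theorem braidValue_fullTwist (n : ℕ) : braidValue q E (fullTwist n) = twistValue q E n := by
  induction n with
  | zero => exact braidValue_nil
  | succ n ih => rw [fullTwist, braidValue_append, ih, braidValue_runAround, twistValue]

theorem braidValue_twistedCable (n : ℕ) :
    braidValue q E (twistedCable n) = (-q ^ 3) ^ n • twistValue q E n := by
  have hcurls : braidValue q E ((List.range n).map Piece.curl) = (-q ^ 3) ^ n • 1 := by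
    rw [← one_pow (M := B) n, ← _root_.smul_pow]
    simp [braidValue, Function.comp_def, pieceValue]
  rw [twistedCable, braidValue_append, braidValue_fullTwist, hcurls, mul_smul_comm, mul_one]

theorem loopValue_curl (hq : q ≠ 0) : q * loopValue q + q⁻¹ = -q ^ 3 := by
  rw [loopValue]
  field_simp
  ring

theorem mul_crossing_mul (x y : B) (i : ℕ) :
    x * (crossing q E i * y) = q • (x * y) + q⁻¹ • (x * E i * y) := by
  simp only [crossing, add_mul, mul_add, smul_mul_assoc, mul_smul_comm, one_mul, mul_assoc]

end Diagrams

/-- All crossings of the diagram fit on `n` strands; curls are not constrained, because they only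
contribute a factor to the bracket. -/
def Fits (n : ℕ) (D : List Piece) : Prop := ∀ i, Piece.cross i ∈ D → i + 1 < n

theorem Fits.append {n : ℕ} {D D' : List Piece} (h : Fits n D) (h' : Fits n D') :
    Fits n (D ++ D') :=
  fun i hi => (List.mem_append.1 hi).elim (h i) (h' i)

theorem fits_blockCross (m n : ℕ) : Fits (m + n) (blockCross m n) := by
  intro i hi
  simp only [blockCross, passRight, List.mem_flatten, List.mem_map, List.mem_reverse,
    List.mem_range, exists_exists_and_eq_and, Piece.cross.injEq] at hi
  obtain ⟨k, hk, j, hj, rfl⟩ := hi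
  omega

theorem fits_hopfCable (m n : ℕ) : Fits (m + n) (hopfCable m n) :=
  (fits_blockCross m n).append (add_comm m n ▸ fits_blockCross n m)

theorem fits_fullTwist (n : ℕ) : Fits n (fullTwist n) := by
  induction n with
  | zero => simp [Fits, fullTwist]
  | succ n ih =>
    refine Fits.append (fun i hi => (ih i hi).trans n.lt_succ_self) fun i hi => ?_
    simp only [runAround, List.mem_append, List.mem_map, List.mem_reverse, List.mem_range,
      Piece.cross.injEq, exists_eq_right, or_self] at hi
    omega

theorem fits_twistedCable (n : ℕ) : Fits n (twistedCable n) :=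
  (fits_fullTwist n).append (by simp [Fits])

/-! ### Specialization to `ℚ(A)` -/

theorem AK_ne_zero : AK ≠ 0 :=
  ((LaurentPolynomial.isUnit_T 1).map (algebraMap Ground K)).ne_zero

theorem algebraMap_A (k : ℤ) : algebraMap Ground K (A k) = AK ^ k := by
  have hnat (n : ℕ) : algebraMap Ground K (A n) = AK ^ n := by
    rw [AK, ← map_pow, A, A, LaurentPolynomial.T_pow, mul_one]
  obtain ⟨n, rfl | rfl⟩ := k.eq_nat_or_neg
  · rw [hnat, zpow_natCast]
  · rw [zpow_neg, zpow_natCast, ← hnat]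
    refine eq_inv_of_mul_eq_one_right ?_
    rw [← map_mul, A, A, ← LaurentPolynomial.T_add, add_neg_cancel, LaurentPolynomial.T_zero,
      map_one]

theorem AK_pow_ne_one {n : ℕ} (hn : n ≠ 0) : AK ^ n ≠ 1 := by
  rw [← zpow_natCast, ← algebraMap_A, ← map_one (algebraMap Ground K),
    (IsFractionRing.injective Ground K).ne_iff]
  intro h
  have hcoeff := congrArg (fun f : Ground => f.coeff (n : ℤ))
    (h.trans LaurentPolynomial.T_zero.symm)
  simp only [A, LaurentPolynomial.T, AddMonoidAlgebra.coeff_single, Finsupp.single_apply, if_true,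
    (Nat.cast_ne_zero.2 hn).symm, if_false] at hcoeff
  exact one_ne_zero hcoeff

theorem algebraMap_lam (n : ℕ) : algebraMap Ground K (lam n) = loopValue (AK ^ (n + 1)) := by
  rw [lam, a, a, map_sub, map_neg, algebraMap_A, algebraMap_A, loopValue, mul_neg, zpow_neg,
    ← pow_mul, mul_comm (n + 1)]
  norm_cast

theorem algebraMap_circleValue : algebraMap Ground K circleValue = loopValue AK := by
  simpa [lam, circleValue] using algebraMap_lam 0

theorem quantumDim_loopValue_mul {F : Type*} [Field F] {q : F} (hq : q ≠ 0) (n : ℕ) :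
    quantumDim (loopValue q) n * (q ^ 2 - (q ^ 2)⁻¹) =
      (-1) ^ n * ((q ^ 2) ^ (n + 1) - ((q ^ 2) ^ (n + 1))⁻¹) := by
  induction n using Nat.twoStepInduction with
  | zero => simp [quantumDim_zero]
  | one =>
    rw [Nat.cast_one, quantumDim_one, loopValue]
    field_simp
    ring
  | more n ih₀ ih₁ =>
    have hrec : quantumDim (loopValue q) (n + 2 : ℕ) =
        loopValue q * quantumDim (loopValue q) (n + 1 : ℕ) - quantumDim (loopValue q) n := by
      simpa [add_assoc, one_add_one_eq_two] using quantumDim_add_one (δ := loopValue q) (n + 1)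
    rw [hrec, sub_mul, mul_assoc, ih₀, ih₁, loopValue]
    field_simp
    ring

theorem aK_ne_zero : aK ≠ 0 := pow_ne_zero _ AK_ne_zero

theorem aK_pow_sub_inv_ne_zero {n : ℕ} (hn : n ≠ 0) : aK ^ n - (aK ^ n)⁻¹ ≠ 0 := by
  have h := pow_ne_zero n aK_ne_zero
  rw [sub_ne_zero, Ne, ← mul_eq_one_iff_eq_inv₀ h, ← pow_add, aK, ← pow_mul]
  exact AK_pow_ne_one (by omega)

theorem aK_sub_inv_ne_zero : aK - aK⁻¹ ≠ 0 := by
  simpa using aK_pow_sub_inv_ne_zero one_ne_zero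

theorem isGeneric_loopValue_AK : IsGeneric (loopValue AK) := fun n =>
  left_ne_zero_of_mul (quantumDim_loopValue_mul AK_ne_zero n ▸
    mul_ne_zero (pow_ne_zero _ (neg_ne_zero.2 one_ne_zero))
      (aK_pow_sub_inv_ne_zero n.succ_ne_zero))

/-! ### The bracket as a trace -/

theorem eval_flatClass (n : ℕ) (E : List ℕ) :
    (flatClass n E).eval circleValue = circleValue ^ circleCount n E := by
  classical
  have hcount : circleCount n E = Nat.card {c : Circle n E // ¬ c.Essential} +
      Nat.card {c : Circle n E // c.Essential} := by
    rw [circleCount, add_comm, ← Nat.card_sum]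
    exact Nat.card_congr (Equiv.sumCompl _).symm
  rw [flatClass, hcount, pow_add, eval_mul, eval_pow, eval_pow, eval_C, eval_X]

theorem algebraMap_eval_resolve {n : ℕ} {D : List Piece} (hD : Fits n D) {E : List ℕ}
    (hE : ∀ i ∈ E, i + 1 < n) :
    algebraMap Ground K ((resolve n D E).eval circleValue) =
      loopValue AK ^ n * markovTrace (loopValue AK)
        ((E.map (turnBack _)).prod * braidValue AK (turnBack _) D) := by
  have hδ := isGeneric_loopValue_AK.ne_zero
  induction D generalizing E with
  | nil =>
    rw [resolve, eval_flatClass, map_pow, algebraMap_circleValue, braidValue_nil, mul_one,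
      markovTrace_prod_turnBack, wordTrace_eq hδ hE, mul_div_cancel₀ _ (pow_ne_zero n hδ)]
  | cons p D ih =>
    have hD' : Fits n D := fun i hi => hD i (List.mem_cons_of_mem _ hi)
    cases p with
    | cross i =>
      have hEi : ∀ j ∈ E ++ [i], j + 1 < n := by
        simpa only [List.mem_append, List.mem_singleton, or_imp, forall_and, forall_eq] using
          ⟨hE, hD i List.mem_cons_self⟩
      rw [braidValue_cons, pieceValue, mul_crossing_mul, resolve, eval_add, eval_smul, eval_smul,
        map_add, map_add, smul_eq_mul, smul_eq_mul, map_mul, map_mul, map_smul, map_smul,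
        smul_eq_mul, smul_eq_mul, ih hD' hE, ih hD' hEi, algebraMap_A, algebraMap_A, zpow_one,
        zpow_neg_one, List.map_append, List.prod_append, List.map_singleton, List.prod_singleton]
      ring
    | curl i =>
      rw [braidValue_cons, pieceValue, smul_mul_assoc, one_mul, mul_smul_comm, map_smul, resolve,
        eval_add, eval_smul, eval_smul, eval_smul, map_add, smul_eq_mul, smul_eq_mul, smul_eq_mul,
        map_mul, map_mul, map_mul, ih hD' hE, algebraMap_A, algebraMap_A, algebraMap_circleValue,
        zpow_one, zpow_neg_one, smul_eq_mul, ← loopValue_curl AK_ne_zero]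
      ring

theorem algebraMap_bracket {n : ℕ} {D : List Piece} (hD : Fits n D) :
    algebraMap Ground K (bracket n D) =
      loopValue AK ^ n * markovTrace (loopValue AK) (braidValue AK (turnBack _) D) := by
  rw [bracket, annularClass, algebraMap_eval_resolve hD (by simp), List.map_nil, List.prod_nil,
    one_mul]

theorem algebraMap_bracket_hopfCable (m n : ℕ) :
    algebraMap Ground K (bracket (m + n) (hopfCable m n)) =
      hopfFunctional AK (turnBack (loopValue AK)) (markovTrace _) m n 1 := by
  rw [algebraMap_bracket (fits_hopfCable m n), hopfCable, braidValue_append,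
    braidValue_blockCross, braidValue_blockCross, hopfFunctional_apply, one_mul]

theorem algebraMap_bracket_twistedCable (n : ℕ) :
    algebraMap Ground K (bracket n (twistedCable n)) =
      twistFunctional AK (turnBack (loopValue AK)) (markovTrace _) n 1 := by
  rw [algebraMap_bracket (fits_twistedCable n), braidValue_twistedCable, map_smul,
    twistFunctional_apply, mul_one, smul_eq_mul, mul_assoc]

/-! ### The Hopf pairing and the twist on Chebyshev polynomials -/

/-- The linear functional on polynomials with value `b n` at `X ^ n`. -/
def linearExtension {R M : Type*} [CommSemiring R] [AddCommMonoid M] [Module R M] (b : ℕ → M) :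
    R[X] →ₗ[R] M :=
  Polynomial.lsum fun n => LinearMap.toSpanSingleton R M (b n)

theorem linearExtension_apply {R M : Type*} [CommSemiring R] [AddCommMonoid M] [Module R M]
    (b : ℕ → M) (x : R[X]) : linearExtension b x = x.sum fun n c => c • b n := rfl

theorem linearExtension_X_pow {R M : Type*} [CommSemiring R] [AddCommMonoid M] [Module R M]
    (b : ℕ → M) (k : ℕ) : linearExtension (R := R) b (X ^ k) = b k := by
  rw [linearExtension_apply, ← monomial_one_right_eq_X_pow, sum_monomial_index, one_smul]
  exact zero_smul _ _

/-- The Hopf pairing with values in `ℚ(A)`, as a linear functional in the second argument. -/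
def pairingForm (x : Skein) : Skein →ₗ[Ground] K :=
  x.sum fun m c =>
    c • linearExtension fun n => algebraMap Ground K (bracket (m + n) (hopfCable m n))

theorem pairingForm_apply (x y : Skein) : pairingForm x y = algebraMap Ground K (pairing x y) := by
  simp only [pairingForm, pairing, linearExtension_apply, Polynomial.sum, LinearMap.sum_apply,
    LinearMap.smul_apply, Algebra.smul_def, Finset.mul_sum, map_sum, map_mul, mul_assoc]

/-- The functional `x ↦ ⟨t(x)⟩` with values in `ℚ(A)`. -/
def twistForm : Skein →ₗ[Ground] K :=
  linearExtension fun n => algebraMap Ground K (bracket n (twistedCable n))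

theorem value_eq (x : Skein) : value x = x.eval circleValue := by
  have hbracket (m : ℕ) : bracket (m + 0) (hopfCable m 0) = circleValue ^ m := by
    have hnil : hopfCable m 0 = [] := by
      simp [hopfCable, blockCross, passRight]
    rw [hnil, bracket, annularClass, resolve, eval_flatClass, circleCount_nil, add_zero]
  simp only [value, pairing, eval_eq_sum, ← C_1, sum_C_index, mul_one, hbracket, mul_zero, zero_mul]

theorem twistForm_apply (x : Skein) : twistForm x = algebraMap Ground K (value (twist x)) := by
  simp only [twistForm, linearExtension_apply, value_eq, twist, Polynomial.sum, eval_finsetSum,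
    eval_smul, smul_eq_mul, map_sum, map_mul, bracket]
  simp only [Algebra.smul_def]

theorem pairingForm_chebyshev (x : Skein) (n : ℕ) : pairingForm x (Chebyshev.S Ground n) =
    aeval (algebraMap Ground K (lam n)) x * quantumDim (loopValue AK) n := by
  have hδ := isGeneric_loopValue_AK
  have hE := isTL_turnBack hδ.ne_zero
  have hτ := isMarkov_markovTrace hδ.ne_zero
  have hpow (m : ℕ) : linearExtension (fun n => algebraMap Ground K
      (bracket (m + n) (hopfCable m n))) (Chebyshev.S Ground n) =
        algebraMap Ground K (lam n) ^ m * quantumDim (loopValue AK) n := by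
    have h := (hτ.isAnnular_hopfFunctional hE AK_ne_zero m).apply_X_pow_mul_chebyshev (hE.shift m)
      hδ (fun k => (linearExtension_X_pow (R := Ground) _ k).trans
        (algebraMap_bracket_hopfCable m k)) 0 n
    rwa [pow_zero, one_mul, add_zero, hτ.hopfFunctional_jonesWenzl hE hδ AK_ne_zero,
      ← algebraMap_lam] at h
  simp only [pairingForm, Polynomial.sum, LinearMap.sum_apply, LinearMap.smul_apply, hpow,
    aeval_def, eval₂_eq_sum, Finset.sum_mul, Algebra.smul_def, mul_assoc]

theorem twistForm_chebyshev (n : ℕ) :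
    twistForm (Chebyshev.S Ground n) = mu n * quantumDim (loopValue AK) n := by
  have hδ := isGeneric_loopValue_AK
  have hE := isTL_turnBack hδ.ne_zero
  have hτ := isMarkov_markovTrace hδ.ne_zero
  have h := (hτ.isAnnular_twistFunctional hE AK_ne_zero).apply_X_pow_mul_chebyshev hE hδ
    (fun k => (linearExtension_X_pow (R := Ground) _ k).trans
      (algebraMap_bracket_twistedCable k)) 0 n
  rwa [pow_zero, one_mul, add_zero, hτ.twistFunctional_jonesWenzl hE hδ] at h

/-! ### Even polynomials -/

theorem X_sq_mul_chebyshev {R : Type*} [CommRing R] (k : ℕ) :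
    X ^ 2 * Chebyshev.S R ↑(2 * (k + 1)) = Chebyshev.S R ↑(2 * (k + 2)) +
      (Chebyshev.S R ↑(2 * (k + 1)) + Chebyshev.S R ↑(2 * (k + 1))) + Chebyshev.S R ↑(2 * k) := by
  have h₀ := Chebyshev.S_add_two R (2 * k)
  have h₁ := Chebyshev.S_add_two R (2 * k + 1)
  have h₂ := Chebyshev.S_add_two R (2 * k + 2)
  push_cast
  ring_nf at h₀ h₁ h₂ ⊢
  linear_combination -h₀ - X * h₁ - h₂

theorem mul_mem_of_mem_span {R S : Type*} [CommSemiring R] [Semiring S] [Algebra R S] {s : Set S}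
    {M : Submodule R S} {a x : S} (h : ∀ y ∈ s, a * y ∈ M) (hx : x ∈ Submodule.span R s) :
    a * x ∈ M :=
  (Submodule.span_le (p := M.comap (LinearMap.mulLeft R a))).2 h hx

theorem chebyshev_two_mul_mem_evenPart (k : ℕ) : Chebyshev.S Ground ↑(2 * k) ∈ evenPart := by
  induction k using Nat.twoStepInduction with
  | zero => exact Submodule.subset_span ⟨0, by simp⟩
  | one =>
    have h₀ : (1 : Skein) ∈ evenPart := Submodule.subset_span ⟨0, by simp⟩
    have h₁ : (X : Skein) ^ 2 ∈ evenPart := Submodule.subset_span ⟨1, by simp⟩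
    simpa [Chebyshev.S_two] using sub_mem h₁ h₀
  | more k ih₀ ih₁ =>
    have hX : X ^ 2 * Chebyshev.S Ground ↑(2 * (k + 1)) ∈ evenPart := by
      refine mul_mem_of_mem_span ?_ ih₁
      rintro _ ⟨j, rfl⟩
      exact Submodule.subset_span ⟨j + 1, by ring⟩
    rw [X_sq_mul_chebyshev, add_assoc] at hX
    exact (Submodule.add_mem_iff_left _ (add_mem (add_mem ih₁ ih₁) ih₀)).1 hX

theorem X_sq_mul_mem_span_chebyshev {x : Skein}
    (hx : x ∈ Submodule.span Ground (Set.range fun k : ℕ => Chebyshev.S Ground ↑(2 * k))) :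
    X ^ 2 * x ∈ Submodule.span Ground (Set.range fun k : ℕ => Chebyshev.S Ground ↑(2 * k)) := by
  refine mul_mem_of_mem_span ?_ hx
  have hmem (k : ℕ) := Submodule.subset_span (R := Ground)
    (Set.mem_range_self (f := fun k : ℕ => Chebyshev.S Ground ↑(2 * k)) k)
  rintro _ ⟨_ | k, rfl⟩
  · have h : X ^ 2 * Chebyshev.S Ground ↑(2 * 0) =
        Chebyshev.S Ground ↑(2 * 1) + Chebyshev.S Ground ↑(2 * 0) := by
      simp [Chebyshev.S_two]
    exact h ▸ add_mem (hmem 1) (hmem 0)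
  · dsimp only
    rw [X_sq_mul_chebyshev]
    exact add_mem (add_mem (hmem _) (add_mem (hmem _) (hmem _))) (hmem _)

theorem evenPart_eq_span_chebyshev : evenPart =
    Submodule.span Ground (Set.range fun k : ℕ => Chebyshev.S Ground ↑(2 * k)) := by
  refine le_antisymm (Submodule.span_le.2 ?_) (Submodule.span_le.2 ?_)
  · rintro _ ⟨k, rfl⟩
    induction k with
    | zero => exact Submodule.subset_span ⟨0, by simp⟩
    | succ k ih =>
      simpa only [← pow_add, mul_add, mul_one, add_comm 2, SetLike.mem_coe] using
        X_sq_mul_mem_span_chebyshev ih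
  · rintro _ ⟨k, rfl⟩
    exact chebyshev_two_mul_mem_evenPart k

/-! ### Newton interpolation -/

section Newton

open Lagrange

variable {F : Type*} [Field F]

theorem nodal_dvd_iff {ι : Type*} {s : Finset ι} {v : ι → F} (hv : Set.InjOn v s) {p : F[X]} :
    nodal s v ∣ p ↔ ∀ i ∈ s, p.eval (v i) = 0 := by
  refine ⟨fun h i hi => dvd_iff_isRoot.1 ((X_sub_C_dvd_nodal v hi).trans h), fun h => ?_⟩
  refine Finset.prod_dvd_of_coprime (fun i hi j hj hij => ?_) fun i hi => dvd_iff_isRoot.2 (h i hi)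
  exact isCoprime_X_sub_C_of_isUnit_sub (sub_ne_zero.2 (hv.ne hi hj hij)).isUnit

theorem eq_C_coeff_mul_nodal {ι : Type*} {s : Finset ι} {v : ι → F} (hv : Set.InjOn v s) {p : F[X]}
    (hdeg : p.degree ≤ s.card) (hp : ∀ i ∈ s, p.eval (v i) = 0) :
    p = C (p.coeff s.card) * nodal s v := by
  have hmonic := (nodal_monic (s := s) (v := v)).coeff_natDegree
  rw [natDegree_nodal] at hmonic
  refine eq_of_degree_sub_lt_of_eval_index_eq s hv ?_ fun i hi => ?_
  · rw [degree_lt_iff_coeff_zero]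
    intro m hm
    rw [coeff_sub, coeff_C_mul]
    rcases hm.eq_or_lt with rfl | hm
    · rw [hmonic, mul_one, sub_self]
    · have hm' : (s.card : WithBot ℕ) < m := WithBot.coe_lt_coe.2 hm
      rw [coeff_eq_zero_of_degree_lt (hdeg.trans_lt hm'),
        coeff_eq_zero_of_degree_lt (degree_nodal.trans_lt hm'), mul_zero, sub_self]
  · rw [hp i hi, eval_mul, eval_nodal_at_node hi, mul_zero]

variable {v c y : ℕ → F}

variable (v y) in
/-- The divided difference `y[v_0, …, v_n]`, the leading coefficient of the polynomial of degree at
most `n` with values `y` at the points `v_0, …, v_n`. -/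
def dividedDifference (n : ℕ) : F :=
  ∑ k ∈ Finset.range (n + 1), y k / ∏ i ∈ (Finset.range (n + 1)).erase k, (v k - v i)

variable (v c y) in
/-- The Newton series with coefficients `c` and nodes `v` has the values `y` at the nodes. At `v_k`
the terms beyond the `k`-th vanish, so that the series is a finite sum. -/
def IsNewtonExpansion : Prop :=
  ∀ k, ∑ n ∈ Finset.range (k + 1), c n * (nodal (Finset.range n) v).eval (v k) = y k

theorem sum_eval_nodal_of_lt {N k : ℕ} (h : k < N) :
    ∑ n ∈ Finset.range N, c n * (nodal (Finset.range n) v).eval (v k) =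
      ∑ n ∈ Finset.range (k + 1), c n * (nodal (Finset.range n) v).eval (v k) := by
  refine (Finset.sum_subset (Finset.range_mono h) fun n _ hn => ?_).symm
  rw [eval_nodal_at_node (by simpa using hn), mul_zero]

theorem IsNewtonExpansion.unique (hv : Function.Injective v) {c' : ℕ → F}
    (h : IsNewtonExpansion v c y) (h' : IsNewtonExpansion v c' y) : c = c' := by
  funext n
  induction n using Nat.strong_induction_on with
  | _ n ih =>
    have heq := (h n).trans (h' n).symm
    rw [Finset.sum_range_succ, Finset.sum_range_succ,
      Finset.sum_congr rfl fun i hi => by rw [ih i (Finset.mem_range.1 hi)]] at heq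
    refine mul_right_cancel₀ (eval_nodal_not_at_node fun i hi => ?_) (add_left_cancel heq)
    exact hv.ne (Finset.mem_range.1 hi).ne'

theorem coeff_interpolate_range_succ (hv : Function.Injective v) (n : ℕ) :
    (interpolate (Finset.range (n + 1)) v y).coeff n = dividedDifference v y n := by
  have hdeg := degree_interpolate_lt (s := Finset.range (n + 1)) y hv.injOn
  have hcoeff := coeff_eq_sum hv.injOn hdeg
  rw [Finset.card_range, Nat.add_sub_cancel] at hcoeff
  rw [hcoeff, dividedDifference]
  exact Finset.sum_congr rfl fun k hk => by rw [eval_interpolate_at_node y hv.injOn hk]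

theorem interpolate_range_succ (hv : Function.Injective v) (n : ℕ) :
    interpolate (Finset.range (n + 1)) v y = interpolate (Finset.range n) v y +
      C (dividedDifference v y n) * nodal (Finset.range n) v := by
  have hdeg (m : ℕ) : (interpolate (Finset.range m) v y).degree < m := by
    simpa only [Finset.card_range] using degree_interpolate_lt (s := Finset.range m) y hv.injOn
  have hsub := eq_C_coeff_mul_nodal (s := Finset.range n) hv.injOn
    (p := interpolate (Finset.range (n + 1)) v y - interpolate (Finset.range n) v y) ?_ ?_
  · rw [Finset.card_range, coeff_sub, coeff_eq_zero_of_degree_lt (hdeg n), sub_zero,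
      coeff_interpolate_range_succ hv] at hsub
    rw [← hsub, add_sub_cancel]
  · rw [Finset.card_range, degree_le_iff_coeff_zero]
    intro m hm
    have hnm : n < m := WithBot.coe_lt_coe.1 hm
    rw [coeff_sub, coeff_eq_zero_of_degree_lt ((hdeg n).trans hm),
      coeff_eq_zero_of_degree_lt ((hdeg (n + 1)).trans_le (WithBot.coe_le_coe.2 hnm)), sub_zero]
  · intro k hk
    have hk' : k ∈ Finset.range (n + 1) := Finset.range_mono n.le_succ hk
    rw [eval_sub, eval_interpolate_at_node y hv.injOn hk, eval_interpolate_at_node y hv.injOn hk',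
      sub_self]

theorem interpolate_range_eq_sum (hv : Function.Injective v) (N : ℕ) :
    interpolate (Finset.range N) v y =
      ∑ n ∈ Finset.range N, C (dividedDifference v y n) * nodal (Finset.range n) v := by
  induction N with
  | zero => simp
  | succ N ih => rw [interpolate_range_succ hv, ih, Finset.sum_range_succ]

theorem isNewtonExpansion_dividedDifference (hv : Function.Injective v) :
    IsNewtonExpansion v (dividedDifference v y) y := by
  intro k
  have h := eval_interpolate_at_node y hv.injOn (Finset.self_mem_range_succ k)
  rw [interpolate_range_eq_sum hv, eval_finsetSum] at h
  simpa only [eval_mul, eval_C] using h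

theorem isNewtonExpansion_iff (hv : Function.Injective v) :
    IsNewtonExpansion v c y ↔ c = dividedDifference v y :=
  ⟨fun h => h.unique hv (isNewtonExpansion_dividedDifference hv),
    fun h => h ▸ isNewtonExpansion_dividedDifference hv⟩

end Newton

/-! ### The completed algebra as an algebra of functions -/

/-- The points `λ_{2k}` in `ℚ(A)`. -/
def node (k : ℕ) : K := algebraMap Ground K (lam (2 * k))

theorem node_eq (k : ℕ) : node k = -aK ^ (2 * k + 1) - (aK ^ (2 * k + 1))⁻¹ := by
  rw [node, algebraMap_lam, loopValue, aK, pow_right_comm]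

theorem node_sub_node {i k : ℕ} (h : i ≤ k) :
    node k - node i = -((aK - aK⁻¹) ^ 2 * (qInt (k - i) * qInt (k + i + 1))) := by
  obtain ⟨j, rfl⟩ := Nat.exists_eq_add_of_le h
  have ha := aK_ne_zero
  have hprod : (aK - aK⁻¹) ^ 2 * (qInt j * qInt (i + j + i + 1)) =
      (aK ^ j - (aK ^ j)⁻¹) * (aK ^ (i + j + i + 1) - (aK ^ (i + j + i + 1))⁻¹) := by
    rw [qInt, qInt, div_mul_div_comm, ← sq, mul_div_cancel₀ _ (pow_ne_zero 2 aK_sub_inv_ne_zero)]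
  rw [Nat.add_sub_cancel_left, hprod, node_eq, node_eq]
  field_simp
  ring

theorem qInt_ne_zero {n : ℕ} (hn : n ≠ 0) : qInt n ≠ 0 :=
  div_ne_zero (aK_pow_sub_inv_ne_zero hn) aK_sub_inv_ne_zero

theorem node_injective : Function.Injective node := by
  refine Function.Injective.of_lt_imp_ne fun i k h => ?_
  rw [ne_comm, ← sub_ne_zero, node_sub_node h.le]
  exact neg_ne_zero.2 (mul_ne_zero (pow_ne_zero _ aK_sub_inv_ne_zero)
    (mul_ne_zero (qInt_ne_zero (by omega)) (qInt_ne_zero (by omega))))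

theorem RK_eq_nodal (n : ℕ) : RK n = Lagrange.nodal (Finset.range n) node := by
  simp [RK, R, Lagrange.nodal, Polynomial.map_prod, node]

theorem mk_RK_eq_mk_iff {n : ℕ} {p q : K[X]} :
    Ideal.Quotient.mk (Ideal.span {RK n}) p = Ideal.Quotient.mk (Ideal.span {RK n}) q ↔
      ∀ k < n, p.eval (node k) = q.eval (node k) := by
  rw [Ideal.Quotient.eq, Ideal.mem_span_singleton, RK_eq_nodal, nodal_dvd_iff node_injective.injOn]
  simp only [eval_sub, sub_eq_zero, Finset.mem_range]

namespace Completed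

/-- The value of a formal series at the point `λ_{2k}`, read off modulo `R_{k+1}`. -/
def eval (k : ℕ) : Completed →+* K :=
  (Ideal.Quotient.lift (Ideal.span {RK (k + 1)}) (evalRingHom (node k)) fun p hp => by
    rw [← Ideal.Quotient.eq_zero_iff_mem, ← map_zero (Ideal.Quotient.mk _), mk_RK_eq_mk_iff] at hp
    simpa using hp k k.lt_succ_self).comp
    ((Pi.evalRingHom (fun n : ℕ => K[X] ⧸ Ideal.span {RK n}) (k + 1)).comp Completed.subtype)

theorem eval_eq {f : Completed} {N k : ℕ} (hk : k < N) {p : K[X]}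
    (hp : (f : ∀ n : ℕ, K[X] ⧸ Ideal.span {RK n}) N = Ideal.Quotient.mk _ p) :
    eval k f = p.eval (node k) := by
  have hmk : (f : ∀ n : ℕ, K[X] ⧸ Ideal.span {RK n}) (k + 1) = Ideal.Quotient.mk _ p := by
    induction N, Nat.succ_le_of_lt hk using Nat.le_induction with
    | base => exact hp
    | succ N hN ih => exact ih hN (by rw [← f.2 N, hp, Ideal.Quotient.factor_mk])
  rw [eval, RingHom.comp_apply]
  change Ideal.Quotient.lift _ _ _ ((f : ∀ n : ℕ, K[X] ⧸ Ideal.span {RK n}) (k + 1)) = _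
  rw [hmk, Ideal.Quotient.lift_mk, coe_evalRingHom]

/-- The formal series with prescribed coefficients. -/
def ofCoeffs (c : ℕ → K) : Completed :=
  ⟨fun N => Ideal.Quotient.mk _ (∑ n ∈ Finset.range N, C (c n) * RK n), fun N => by
    rw [Ideal.Quotient.factor_mk, Ideal.Quotient.eq, Finset.sum_range_succ, add_sub_cancel_left]
    exact Ideal.mul_mem_left _ _ (Ideal.mem_span_singleton_self _)⟩

theorem hasExpansion_ofCoeffs (c : ℕ → K) : HasExpansion (ofCoeffs c) c := fun _ => rfl

theorem hasExpansion_iff_isNewtonExpansion {f : Completed} {c : ℕ → K} :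
    HasExpansion f c ↔ IsNewtonExpansion node c fun k => eval k f := by
  have hsum (N k : ℕ) : (∑ n ∈ Finset.range N, C (c n) * RK n).eval (node k) =
      ∑ n ∈ Finset.range N, c n * (Lagrange.nodal (Finset.range n) node).eval (node k) := by
    simp only [eval_finsetSum, eval_mul, eval_C, RK_eq_nodal]
  refine ⟨fun h k => ?_, fun h N => ?_⟩
  · dsimp only
    rw [← hsum, eval_eq k.lt_succ_self (h (k + 1))]
  · obtain ⟨p, hp⟩ := Ideal.Quotient.mk_surjective ((f : ∀ n : ℕ, K[X] ⧸ Ideal.span {RK n}) N)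
    rw [← hp, mk_RK_eq_mk_iff]
    intro k hk
    rw [← eval_eq hk hp.symm, hsum, sum_eval_nodal_of_lt hk, h k]

theorem bijective_eval : Function.Bijective (RingHom.pi eval) := by
  refine ⟨fun f g h => Subtype.ext (funext fun N => ?_), fun y => ?_⟩
  · have hexp (f : Completed) := hasExpansion_iff_isNewtonExpansion.2
      (isNewtonExpansion_dividedDifference node_injective (y := RingHom.pi eval f))
    rw [hexp f N, h, ← hexp g N]
  · refine ⟨ofCoeffs (dividedDifference node y), funext fun k => ?_⟩
    exact (hasExpansion_iff_isNewtonExpansion.1 (hasExpansion_ofCoeffs _) k).symm.trans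
      (isNewtonExpansion_dividedDifference node_injective k)

/-- The completed algebra is the algebra of all functions on the points `λ_0, λ_2, λ_4, …`. -/
def values : Completed ≃+* (ℕ → K) := RingEquiv.ofBijective _ bijective_eval

theorem hasExpansion_iff {f : Completed} {c : ℕ → K} :
    HasExpansion f c ↔ c = dividedDifference node (values f) :=
  hasExpansion_iff_isNewtonExpansion.trans (isNewtonExpansion_iff node_injective)

end Completed

/-! ### The coefficients -/

theorem qFactorial_succ (n : ℕ) : qFactorial (n + 1) = qFactorial n * qInt (n + 1) :=
  Finset.prod_range_succ _ _

theorem qFactorial_ne_zero (n : ℕ) : qFactorial n ≠ 0 :=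
  Finset.prod_ne_zero_iff.2 fun _ _ => qInt_ne_zero (Nat.succ_ne_zero _)

theorem qFactorial_add (m n : ℕ) :
    qFactorial (m + n) = qFactorial m * ∏ i ∈ Finset.range n, qInt (m + i + 1) :=
  Finset.prod_range_add _ _ _

theorem prod_qInt_sub (n : ℕ) : ∏ i ∈ Finset.range n, qInt (n - i) = qFactorial n := by
  rw [qFactorial, ← Finset.prod_range_reflect]
  refine Finset.prod_congr rfl fun i hi => ?_
  have := Finset.mem_range.1 hi
  congr 1
  omega

theorem prod_range_node_sub (k : ℕ) :
    (∏ i ∈ Finset.range k, (node k - node i)) * qInt (2 * k + 1) =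
      (-1) ^ k * (aK - aK⁻¹) ^ (2 * k) * qFactorial (2 * k + 1) := by
  have hfactor {i : ℕ} (hi : i ∈ Finset.range k) : node k - node i =
      -(aK - aK⁻¹) ^ 2 * (qInt (k - i) * qInt (k + i + 1)) := by
    rw [node_sub_node (Finset.mem_range.1 hi).le, neg_mul]
  rw [Finset.prod_congr rfl fun i hi => hfactor hi, Finset.prod_mul_distrib, Finset.prod_const,
    Finset.prod_mul_distrib, Finset.card_range, prod_qInt_sub, ← qFactorial_add, neg_pow,
    ← pow_mul, qFactorial_succ, two_mul k, mul_assoc]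

theorem prod_erase_node_sub {n k : ℕ} (h : k ≤ n) :
    (∏ i ∈ (Finset.range (n + 1)).erase k, (node k - node i)) * qInt (2 * k + 1) =
      (-1) ^ k * (aK - aK⁻¹) ^ (2 * n) * (qFactorial (n + k + 1) * qFactorial (n - k)) := by
  induction n, h using Nat.le_induction with
  | base =>
    rw [Finset.range_add_one, Finset.erase_insert Finset.notMem_range_self, prod_range_node_sub,
      Nat.sub_self, ← two_mul, show qFactorial 0 = 1 from rfl, mul_one]
  | succ n hn ih =>
    rw [Finset.range_add_one, Finset.erase_insert_of_ne (Nat.lt_succ_of_le hn).ne',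
      Finset.prod_insert (by simp), mul_assoc, ih, ← neg_sub, node_sub_node (hn.trans n.le_succ),
      Nat.succ_sub hn, Nat.add_right_comm n 1 k, qFactorial_succ (n - k),
      qFactorial_succ (n + k + 1), Nat.succ_eq_add_one]
    ring

theorem dividedDifference_node (y : ℕ → K) (n : ℕ) :
    dividedDifference node y n = 1 / (aK - aK⁻¹) ^ (2 * n) *
      ∑ k ∈ Finset.range (n + 1), (-1) ^ k * y k * qInt (2 * k + 1) /
        (qFactorial (n + k + 1) * qFactorial (n - k)) := by
  rw [dividedDifference, Finset.mul_sum]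
  refine Finset.sum_congr rfl fun k hk => ?_
  have hpow := pow_ne_zero (2 * n) aK_sub_inv_ne_zero
  have hfact := mul_ne_zero (qFactorial_ne_zero (n + k + 1)) (qFactorial_ne_zero (n - k))
  have hqInt : qInt (2 * k + 1) ≠ 0 := qInt_ne_zero (Nat.succ_ne_zero _)
  have hsign : ((-1 : K) ^ k) * (-1) ^ k = 1 := by rw [← mul_pow, neg_one_mul, neg_neg, one_pow]
  rw [← mul_div_mul_right _ _ hqInt, prod_erase_node_sub (Finset.mem_range_succ_iff.1 hk),
    one_div_mul_eq_div, div_div,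
    div_eq_div_iff (mul_ne_zero (mul_ne_zero (left_ne_zero_of_mul_eq_one hsign) hpow) hfact)
      (mul_ne_zero hfact hpow)]
  generalize aK - aK⁻¹ = b
  linear_combination -(y k * qInt (2 * k + 1) * b ^ (2 * n) *
    (qFactorial (n + k + 1) * qFactorial (n - k))) * hsign

/-! ### The twist element -/

/-- The function `k ↦ μ_{2k}`, whose value at `k` is the eigenvalue of the twist that belongs to the
point `λ_{2k}`. -/
def twistEigenvalues : (ℕ → K)ˣ :=
  MulEquiv.piUnits.symm fun k => Units.mk0 (mu (2 * k)) <|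
    mul_ne_zero (pow_ne_zero _ (neg_ne_zero.2 one_ne_zero)) (pow_ne_zero _ AK_ne_zero)

theorem twistEigenvalues_zpow_apply (p : ℤ) (k : ℕ) :
    ((twistEigenvalues ^ p : (ℕ → K)ˣ) : ℕ → K) k = mu (2 * k) ^ p := by
  rw [Units.val_zpow_eq_zpow_val, Pi.pow_apply]
  rfl

theorem eventually_eq_of_mem_span {ι S M N : Type*} [Semiring S] [AddCommMonoid M]
    [AddCommMonoid N] [Module S M] [Module S N] {l : Filter ι} {L : ι → M →ₗ[S] N} {T : M →ₗ[S] N}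
    {s : Set M} (h : ∀ x ∈ s, ∀ᶠ i in l, L i x = T x) {x : M} (hx : x ∈ Submodule.span S s) :
    ∀ᶠ i in l, L i x = T x := by
  induction hx using Submodule.span_induction with
  | mem x hx => exact h x hx
  | zero => simp only [map_zero, Filter.eventually_true]
  | add x y _ _ hx hy => filter_upwards [hx, hy] with i hx hy using by rw [map_add, map_add, hx, hy]
  | smul r x _ hx => filter_upwards [hx] with i hx using by rw [map_smul, map_smul, hx]

theorem pairingForm_R_chebyshev (n k : ℕ) :
    pairingForm (R n) (Chebyshev.S Ground ↑(2 * k)) =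
      (Lagrange.nodal (Finset.range n) node).eval (node k) *
        quantumDim (loopValue AK) ↑(2 * k) := by
  rw [pairingForm_chebyshev, aeval_def, ← eval_map, ← RK_eq_nodal]
  rfl

theorem eventually_sum_pairingForm_eq_twistForm_iff {c : ℕ → K} :
    (∀ x ∈ evenPart, ∀ᶠ N in Filter.atTop,
      ∑ n ∈ Finset.range N, c n * pairingForm (R n) x = twistForm x) ↔
      IsNewtonExpansion node c fun k => mu (2 * k) := by
  have hchebyshev {N k : ℕ} (h : k < N) :
      ∑ n ∈ Finset.range N, c n * pairingForm (R n) (Chebyshev.S Ground ↑(2 * k)) =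
          twistForm (Chebyshev.S Ground ↑(2 * k)) ↔
        ∑ n ∈ Finset.range (k + 1), c n * (Lagrange.nodal (Finset.range n) node).eval (node k) =
          mu (2 * k) := by
    simp only [pairingForm_R_chebyshev, twistForm_chebyshev, ← mul_assoc, ← Finset.sum_mul]
    rw [sum_eval_nodal_of_lt h, mul_left_inj' (isGeneric_loopValue_AK _)]
  refine ⟨fun h k => ?_, fun h x hx => ?_⟩
  · obtain ⟨N, hN, hkN⟩ := ((h _ (chebyshev_two_mul_mem_evenPart k)).and
      (Filter.eventually_gt_atTop k)).exists
    exact (hchebyshev hkN).1 hN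
  · rw [evenPart_eq_span_chebyshev] at hx
    have hspan := eventually_eq_of_mem_span (l := Filter.atTop) (T := twistForm)
      (L := fun N => ∑ n ∈ Finset.range N, c n • pairingForm (R n)) ?_ hx
    · simpa only [LinearMap.sum_apply, LinearMap.smul_apply, smul_eq_mul] using hspan
    · rintro _ ⟨k, rfl⟩
      filter_upwards [Filter.eventually_gt_atTop k] with N hN
      simpa only [LinearMap.sum_apply, LinearMap.smul_apply, smul_eq_mul]
        using (hchebyshev hN).2 (h k)

theorem inducesTwist_iff {f : Completed} :
    InducesTwist f ↔ Completed.values f = twistEigenvalues := by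
  have hiff (c : ℕ → K) : (∀ x ∈ evenPart, ∀ᶠ N in Filter.atTop,
      ∑ n ∈ Finset.range N, c n * algebraMap Ground K (pairing (R n) x) =
        algebraMap Ground K (value (twist x))) ↔ IsNewtonExpansion node c twistEigenvalues := by
    simp only [← pairingForm_apply, ← twistForm_apply]
    exact eventually_sum_pairingForm_eq_twistForm_iff
  simp only [InducesTwist, hiff, Completed.hasExpansion_iff_isNewtonExpansion]
  refine ⟨fun ⟨c, hf, ht⟩ => funext fun k => (hf k).symm.trans (ht k), fun h => ?_⟩
  have hc := isNewtonExpansion_dividedDifference node_injective (y := twistEigenvalues)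
  exact ⟨_, h ▸ hc, hc⟩

end

end KauffmanSkein

open KauffmanSkein in
/-- There is exactly one `ω` with `⟨ω, x⟩ = ⟨t(x)⟩` for all even `x`; it is invertible, and for all
`p ∈ ℤ` the coefficients of `ω ^ p = ∑ c_{n,p} R_n` are unique and given by the formula. -/
theorem mainTheorem2 :
    ∃ ω : Completedˣ, (∀ f : Completed, InducesTwist f ↔ f = ω) ∧
      ∀ (p : ℤ) (c : ℕ → K), HasExpansion ((ω ^ p : Completedˣ) : Completed) c ↔
        ∀ n : ℕ, c n = 1 / (aK - aK⁻¹) ^ (2 * n) *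
          ∑ k ∈ Finset.range (n + 1),
            (-1) ^ k * mu (2 * k) ^ p * qInt (2 * k + 1) /
              (qFactorial (n + k + 1) * qFactorial (n - k)) := by
  let ω : Completedˣ := Units.mapEquiv Completed.values.symm.toMulEquiv twistEigenvalues
  have hω (p : ℤ) : Completed.values (ω ^ p : Completedˣ) = (twistEigenvalues ^ p : (ℕ → K)ˣ) := by
    rw [← map_zpow]
    exact Completed.values.apply_symm_apply _
  refine ⟨ω, fun f => ?_, fun p c => ?_⟩
  · exact inducesTwist_iff.trans Completed.values.toEquiv.eq_symm_apply.symm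
  · rw [Completed.hasExpansion_iff, hω, funext_iff]
    simp only [dividedDifference_node, twistEigenvalues_zpow_apply]
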